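/- **Theorem (Upper bounds).** Let $G=(\mathcal A,E)$ be a finite undirected graph whose vertices are the arms, with maximum degree $d$. Let $\mathcal P=\{p(\mu):\mu\in\Theta\}$ be either the family of real Gaussian laws with variance $1$, with $\Theta=\mathbb R$, or the family of Bernoulli laws, with $\Theta=(0,1)$; here $p(\mu)$ has mean $\mu$. Write $\mathrm{KL}(\mu|\mu')$ for the Kullback–Leibler divergence of $p(\mu)$ from $p(\mu')$ (in the Bernoulli case also for $\mu,\mu'\in[0,1]$, with values in $[0,\infty]$), and put $\mathrm{KL}^+(\mu|\mu')=\mathrm{KL}(\mu|\mu')$ if $\mu<\mu'$ and $0$ otherwise. Arm $a$ has reward law $\nu_a=p(\mu_a)$ with $\mu_a\in\Theta$. The configuration $\nu=(\nu_a)_{a\in\mathcal A}$ is unimodal: there is a unique optimal arm $a^\star$, with mean $\mu^\star=\max_a\mu_a$, and every other arm is joined to $a^\star$ by a path of $G$ along which the means increase strictly. Let $\mathcal V_a$ be the set of neighbours of $a$ in $G$. At each time $t\ge1$ an arm $a_t$ is chosen from the past (possibly with extra randomization), and a reward $X_t$ is received whose conditional law given the past and $a_t$ is $\nu_{a_t}$.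 Let $N_a(t)$ be the number of pulls of $a$ up to time $t$. Let $\hat\mu_a(t)$ be the empirical mean of its rewards ($0$ if $N_a(t)=0$), and put $\hat\mu^\star(t)=\max_a\hat\mu_a(t)$. At each time $t\ge 1$ let $\hat a^\star_t$ be an arm with the fewest pulls among the arms $a$ with $\hat\mu_a(t)=\hat\mu^\star(t)$. Put $I_a(t)=N_a(t)\,\mathrm{KL}(\hat\mu_a(t)|\hat\mu^\star(t))+\log N_a(t)$, with the conventions $0\times\infty=0$ and $\log 0=-\infty$. All strategies pull an arbitrary first arm; all choices below are arbitrary unless a rule is given. For $t\ge1$: * **IMED-UB** pulls $a_{t+1}\in\arg\min_{a\in\{\hat a^\star_t\}\cup\mathcal V_{\hat a^\star_t}}I_a(t)$. * **KLUCB-UB** pulls $a_{t+1}\in\arg\max_{a\in\{\hat a^\star_t\}\cup\mathcal V_{\hat a^\star_t}}U_a(t)$. Here $U_a(t)$ is the largest $u\ge\hat\mu_a(t)$ in the closure of $\Theta$ ($+\infty$ if such $u$ are unbounded) with $N_a(t)\,\mathrm{KL}(\hat\mu_a(t)|u)+\log N_a(t)\le\log N_{\hat a^\star_t}(t)$, and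 $U_a(t)=\hat\mu_a(t)$ if $N_a(t)>N_{\hat a^\star_t}(t)$. Ties in the $\arg\max$ are broken so that $N_{a_{t+1}}(t)\le N_{\hat a^\star_t}(t)$, which is always possible. * **d-IMED-UB** ($G$ a tree) chooses $\underline a_t\in\arg\min_{a\in\{\hat a^\star_t\}\cup\mathcal V_{\hat a^\star_t}}I_a(t)$. If $\underline a_t=\hat a^\star_t$ it pulls $a_{t+1}=\underline a_t$. Otherwise it pulls $a_{t+1}\in\arg\min_{a\in\mathcal S_t}\big(N_a(t)\,\mathrm{KL}^+(\hat\mu_a(t)|\hat\mu_{\underline a_t}(t))+\log N_a(t)\big)$, where $\mathcal S_t$ is any set of arms that contains $\underline a_t$ and is contained in the component of $\underline a_t$ after the edge $(\underline a_t,\hat a^\star_t)$ is removed from $G$. Let $\epsilon_\nu=\min\{1-\mu^\star,\ \min_{a\ne a'}|\mu_a-\mu_{a'}|/4\}$, $C_\epsilon=34\log(1/\epsilon)\,\epsilon^{-6}$ and $\log^+x=\max(\log x,0)$, with $\log^+0=0$. There is a non-negative function $\alpha_\nu$, depending only on $\nu$, non-decreasing on $(0,\epsilon_\nu)$, with $\lim_{\epsilon\downarrow0}\alpha_\nu(\epsilon)=0$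 and, for all $0<\epsilon<\epsilon_\nu$ and all arms with $\mu_a<\mu_{a'}$, $$\frac{\mathrm{KL}(\mu_a|\mu_{a'})}{1+\alpha_\nu(\epsilon)}\le\mathrm{KL}(\mu_a+\epsilon\,|\,\mu_{a'}-\epsilon)\le(1+\alpha_\nu(\epsilon))\,\mathrm{KL}(\mu_a|\mu_{a'}),$$ such that the following holds for all $0<\epsilon<\epsilon_\nu$ with $\epsilon\le 1/2$ and all $T\ge1$. 1. Under IMED-UB and under KLUCB-UB, for all $a\in\mathcal V_{a^\star}$, $$\mathbb E_\nu[N_a(T)]\le\frac{1+\alpha_\nu(\epsilon)}{\mathrm{KL}(\mu_a|\mu^\star)}\log T+d|\mathcal A|^2C_\epsilon+1,$$ and for all $a\notin\{a^\star\}\cup\mathcal V_{a^\star}$, $\ \mathbb E_\nu[N_a(T)]\le d|\mathcal A|^2C_\epsilon+1$. 2. If $G$ is a tree, then under d-IMED-UB the first bound of part 1 holds for all $a\in\mathcal V_{a^\star}$, and for all $a\notin\{a^\star\}\cup\mathcal V_{a^\star}$, $$\mathbb E_\nu[N_a(T)]\le\frac{1+\alpha_\nu(\epsilon)}{\min_{\underline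 a\in\mathcal V_{a^\star}}\mathrm{KL}(\mu_a|\mu_{\underline a})}\,\log^+\!\Big(\frac{1+\alpha_\nu(\epsilon)}{\min_{\underline a\in\mathcal V_{a^\star}}\mathrm{KL}(\mu_{\underline a}|\mu^\star)}\log T\Big)+d|\mathcal A|^2C_\epsilon+1.$$ -/

import Mathlib

open MeasureTheory ProbabilityTheory InformationTheory Filter Topology
open scoped ENNReal

namespace UnimodalBandit

/-- The two families of reward distributions: real Gaussian laws of variance `1`, and Bernoulli
laws on `{0, 1}`. A member of a family is identified by its mean. -/
inductive RewardFamily where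
  | gaussian : RewardFamily
  | bernoulli : RewardFamily

namespace RewardFamily

/-- The set `Θ` of means of the family. -/
def means : RewardFamily → Set ℝ
  | gaussian => Set.univ
  | bernoulli => Set.Ioo 0 1

/-- The closure of `Θ`: the values that empirical means can take, and the range over which
upper confidence bounds are computed. -/
def closedMeans : RewardFamily → Set ℝ
  | gaussian => Set.univ
  | bernoulli => Set.Icc 0 1

/-- The member of the family with mean `m`, as a measure on `ℝ`. In the Bernoulli case `m` is meant
to lie in `[0, 1]`, and other values are truncated to this interval. -/
noncomputable def law : RewardFamily → ℝ → Measure ℝ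
  | gaussian, m => gaussianReal m 1
  | bernoulli, m => bernoulliMeasure (1 : ℝ) 0 (Set.projIcc (0 : ℝ) 1 zero_le_one m)

/-- The Kullback-Leibler divergence `KL(m | m')` between the members with means `m` and `m'`,
with values in `[0, ∞]`. -/
noncomputable def kl (F : RewardFamily) (m m' : ℝ) : ℝ≥0∞ :=
  klDiv (F.law m) (F.law m')

/-- `KL⁺(m | m')`, equal to `KL(m | m')` if `m < m'` and to `0` otherwise. -/
noncomputable def klPos (F : RewardFamily) (m m' : ℝ) : ℝ≥0∞ :=
  if m < m' then F.kl m m' else 0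

end RewardFamily

/-! ### Unimodal structure -/

/-- The means `μ` are unimodal on the graph `G` with optimal arm `astar`: `astar` is the unique arm
of maximal mean, and every other arm is joined to it by a path in `G` along which the means
increase strictly. -/
structure IsUnimodal {A : Type*} (G : SimpleGraph A) (μ : A → ℝ) (astar : A) : Prop where
  optimal : ∀ a, a ≠ astar → μ a < μ astar
  path : ∀ a, a ≠ astar → ∃ p : G.Walk a astar, p.support.IsChain (fun b c => μ b < μ c)

/-- `ε_ν = min {1 - μ⋆, min_{a ≠ a'} |μ_a - μ_a'| / 4}`. -/
noncomputable def epsNu {A : Type*} (μ : A → ℝ) : ℝ :=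
  min (1 - ⨆ a, μ a) (⨅ p : {p : A × A // p.1 ≠ p.2}, |μ p.1.1 - μ p.1.2| / 4)

/-- `C_ε = 34 log(1/ε) ε⁻⁶`. -/
noncomputable def Ceps (ε : ℝ) : ℝ := 34 * Real.log (1 / ε) * ε⁻¹ ^ 6

/-! ### Stochastic bandit model -/

/-- A run of a bandit whose arm `a` has reward law `ν a`. At time `t ≥ 1` the arm `arm t` is pulled
and the reward `X t` is received (the values at time `0` play no role); `ℱ t` is the information
available after time `t`, which may include randomization by the learner. The next arm depends only
on the past, and, given the past, the next reward follows the law of the arm that is pulled. -/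
structure IsBanditRun {A Ω : Type*} {mΩ : MeasurableSpace Ω} (P : Measure Ω) (ℱ : Filtration ℕ mΩ)
    (ν : A → Measure ℝ) (arm : ℕ → Ω → A) (X : ℕ → Ω → ℝ) : Prop where
  arm_past : ∀ (t : ℕ) (a : A), MeasurableSet[ℱ t] {ω | arm (t + 1) ω = a}
  reward_observed : ∀ t : ℕ, Measurable[ℱ (t + 1)] (X (t + 1))
  reward_law : ∀ (t : ℕ) (B : Set ℝ), MeasurableSet B →
    P[(X (t + 1) ⁻¹' B).indicator (fun _ => (1 : ℝ)) | ℱ t]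
      =ᵐ[P] fun ω => (ν (arm (t + 1) ω)).real B

/-! ### Statistics of a sample path

Here `arm : ℕ → A` and `x : ℕ → ℝ` are one realization of the arms and of the rewards. -/

/-- `N_a(t)`, the number of pulls of arm `a` among the times `1, …, t`. -/
def pulls {A : Type*} [DecidableEq A] (arm : ℕ → A) (t : ℕ) (a : A) : ℕ :=
  ((Finset.Icc 1 t).filter (fun s => arm s = a)).card

/-- The empirical mean of the rewards of arm `a` at time `t` (equal to `0` if `a` has not been
pulled yet). -/
noncomputable def empMean {A : Type*} [DecidableEq A] (arm : ℕ → A) (x : ℕ → ℝ) (t : ℕ) (a : A) :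
    ℝ :=
  (∑ s ∈ (Finset.Icc 1 t).filter (fun s => arm s = a), x s) / (pulls arm t a : ℝ)

/-- The largest empirical mean at time `t`. -/
noncomputable def bestMean {A : Type*} [DecidableEq A] (arm : ℕ → A) (x : ℕ → ℝ) (t : ℕ) : ℝ :=
  ⨆ a, empMean arm x t a

/-- The set of arms with largest empirical mean at time `t`. -/
def bestArms {A : Type*} [DecidableEq A] (arm : ℕ → A) (x : ℕ → ℝ) (t : ℕ) : Set A :=
  {b | ∀ a, empMean arm x t a ≤ empMean arm x t b}

/-- `b` is an admissible current best arm `â⋆_t`: it has the fewest pulls among the arms with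
largest empirical mean. -/
def IsLeader {A : Type*} [DecidableEq A] (arm : ℕ → A) (x : ℕ → ℝ) (t : ℕ) (b : A) : Prop :=
  b ∈ bestArms arm x t ∧ IsMinOn (pulls arm t) (bestArms arm x t) b

/-- `{b} ∪ 𝒱_b`. -/
def closedNbhd {A : Type*} (G : SimpleGraph A) (b : A) : Set A := {b} ∪ G.neighborSet b

/-- `N_a(t) k + log N_a(t)`, where `k` is a divergence, with `0 × ∞ = 0` and `log 0 = -∞`. -/
noncomputable def indexWith {A : Type*} [DecidableEq A] (arm : ℕ → A) (t : ℕ) (a : A) (k : ℝ≥0∞) :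
    EReal :=
  (((pulls arm t a : ℝ≥0∞) * k : ℝ≥0∞) : EReal) + ENNReal.log (pulls arm t a : ℝ≥0∞)

/-! ### The strategy IMED-UB -/

/-- The index `I_a(t) = N_a(t) KL(μ̂_a(t) | μ̂⋆(t)) + log N_a(t)`. -/
noncomputable def imedIndex {A : Type*} [DecidableEq A] (F : RewardFamily) (arm : ℕ → A)
    (x : ℕ → ℝ) (t : ℕ) (a : A) : EReal :=
  indexWith arm t a (F.kl (empMean arm x t a) (bestMean arm x t))

/-- The sample path is produced by IMED-UB: the first arm is arbitrary, and at each time `t ≥ 1`,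
for some choice of a current best arm `b`, the arm pulled next minimizes the index over `{b} ∪ 𝒱_b`.
Ties are broken arbitrarily. -/
def FollowsIMEDUB {A : Type*} [DecidableEq A] (F : RewardFamily) (G : SimpleGraph A) (arm : ℕ → A)
    (x : ℕ → ℝ) : Prop :=
  ∀ t : ℕ, 1 ≤ t → ∃ b : A, IsLeader arm x t b ∧
    arm (t + 1) ∈ closedNbhd G b ∧
    IsMinOn (imedIndex F arm x t) (closedNbhd G b) (arm (t + 1))

/-! ### The strategy KLUCB-UB -/

/-- The upper confidence bound `U_a(t)` relative to the current best arm `b`: the largest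
`u ≥ μ̂_a(t)` with `N_a(t) KL(μ̂_a(t) | u) + log N_a(t) ≤ log N_b(t)`, and `μ̂_a(t)` if
`N_a(t) > N_b(t)`. It is `+∞` if the admissible values `u` are unbounded, which happens for the
arms without pulls in the Gaussian case. -/
noncomputable def ucb {A : Type*} [DecidableEq A] (F : RewardFamily) (arm : ℕ → A) (x : ℕ → ℝ)
    (t : ℕ) (b a : A) : EReal :=
  if pulls arm t b < pulls arm t a then (empMean arm x t a : EReal)
  else sSup (Real.toEReal '' {u : ℝ | u ∈ F.closedMeans ∧ empMean arm x t a ≤ u ∧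
    indexWith arm t a (F.kl (empMean arm x t a) u) ≤ ENNReal.log (pulls arm t b : ℝ≥0∞)})

/-- The sample path is produced by KLUCB-UB: the first arm is arbitrary, and at each time `t ≥ 1`,
for some choice of a current best arm `b`, the arm pulled next maximizes the upper confidence bound
over `{b} ∪ 𝒱_b`. Ties are broken arbitrarily among the maximizers with at most as many pulls as
`b` (there is always one: a maximizer with more pulls than `b` has upper confidence bound at most
that of `b`, so that `b` is then a maximizer as well). -/
def FollowsKLUCBUB {A : Type*} [DecidableEq A] (F : RewardFamily) (G : SimpleGraph A) (arm : ℕ → A)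
    (x : ℕ → ℝ) : Prop :=
  ∀ t : ℕ, 1 ≤ t → ∃ b : A, IsLeader arm x t b ∧
    arm (t + 1) ∈ closedNbhd G b ∧
    IsMaxOn (ucb F arm x t b) (closedNbhd G b) (arm (t + 1)) ∧
    pulls arm t (arm (t + 1)) ≤ pulls arm t b

/-! ### The strategy d-IMED-UB -/

/-- The vertices of the connected component of `c` after the edge `{c, b}` has been removed. -/
def cutSide {A : Type*} (G : SimpleGraph A) (b c : A) : Set A :=
  {a | (G.deleteEdges {s(c, b)}).Reachable c a}

/-- The second order index `N_a(t) KL⁺(μ̂_a(t) | μ̂_c(t)) + log N_a(t)` of `a` relative to `c`. -/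
noncomputable def secondIndex {A : Type*} [DecidableEq A] (F : RewardFamily) (arm : ℕ → A)
    (x : ℕ → ℝ) (t : ℕ) (c a : A) : EReal :=
  indexWith arm t a (F.klPos (empMean arm x t a) (empMean arm x t c))

/-- The sample path is produced by d-IMED-UB: the first arm is arbitrary, and at each time `t ≥ 1`,
for some choice of a current best arm `b` and of an arm `c` with minimal index in `{b} ∪ 𝒱_b`, the
arm `c` is pulled if `c = b`, and otherwise an arm with minimal second order index relative to `c`
in some set `S` that contains `c` and lies on the side of `c` when the edge `{c, b}` is cut. The set
`S` is arbitrary and may depend on `t` and on the path. Ties are broken arbitrarily. -/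
def FollowsDIMEDUB {A : Type*} [DecidableEq A] (F : RewardFamily) (G : SimpleGraph A) (arm : ℕ → A)
    (x : ℕ → ℝ) : Prop :=
  ∀ t : ℕ, 1 ≤ t → ∃ b c : A, IsLeader arm x t b ∧
    c ∈ closedNbhd G b ∧ IsMinOn (imedIndex F arm x t) (closedNbhd G b) c ∧
    (c = b → arm (t + 1) = c) ∧
    (c ≠ b → ∃ S : Set A, c ∈ S ∧ S ⊆ cutSide G b c ∧
      arm (t + 1) ∈ S ∧ IsMinOn (secondIndex F arm x t c) S (arm (t + 1)))

end UnimodalBandit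

/-!
# Upper bounds for unimodal bandits

The pulls of a suboptimal arm `a` are counted by the number `n` of its previous pulls. For each
`n ≥ 1` there are two exceptional events, neither of which refers to the pulled arm or to the time.

* `Unreliable`: some arm has, after at least `n` pulls, an empirical mean off by `ε` or more.
* `Underrated`: some arm `c` has an empirical mean below `μ c - ε`, and the IMED index of `c`
  relative to `μ c - ε` is at least `log n`.

*Deterministic part.* Suppose that `a` is pulled while it has `n` pulls, and that neither event
occurs. Then the current best arm is the optimal one. If it were another arm `b`, it would be
reliable, since it has at least `n` pulls. A neighbour `c` of `b` with a larger mean exists by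
unimodality, its empirical mean lies below `μ c - ε`, and its index is at least `log n`, so that `c`
is underrated (`leader_eq_of_log_le_imedIndex`). This is immediate for IMED-UB and d-IMED-UB. Under
KLUCB-UB the index of `c` may be smaller than `log n`, but then `b` has more than `n` pulls and one
argues at the time of the last pull of `b` (`FollowsKLUCBUB.leader_eq`). Once the current best arm
is optimal and all arms concerned are reliable, the rule of the strategy bounds `n` by `log T`
divided by a divergence with means shifted by `ε`. For d-IMED-UB on a tree, two such bounds are
chained, through the neighbour of the optimal arm that lies on the way from `a`. The function
`klSlack` measures what is lost by the shifts.

*Probabilistic part.* The probabilities of the exceptional events, summed over `n`, are at most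
`5 ε⁻⁶` times the number of arms (`IsBanditRun.sum_measure_exceptional_le`). All deviation bounds
come from one maximal inequality (`IsBanditRun.mul_measure_exists_le_weight`) for products of
likelihood ratios along the pulls of one arm. For the underrated arms, the possible pairs of a
number of pulls `m` and an empirical mean `x` are cut into countably many classes. A class has
probability about `exp (-m KL(x | μ c))` and is relevant for at most `m exp (m KL(x | μ c - ε))`
values of `n`. By superadditivity of the divergence along the line (`RewardFamily.klReal_add_le`)
the product is at most `m exp (-m KL(μ c - ε | μ c))` in the Bernoulli case; in the Gaussian case
the product also decays in `x`, which makes up for the unbounded range of `x`.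
-/

namespace UnimodalBandit

/-! ### Kullback-Leibler divergences of the two families -/

namespace RewardFamily

lemma means_subset_closedMeans (F : RewardFamily) : F.means ⊆ F.closedMeans := by
  cases F
  · exact subset_rfl
  · exact Set.Ioo_subset_Icc_self

lemma ordConnected_means (F : RewardFamily) : F.means.OrdConnected := by
  cases F
  · exact Set.ordConnected_univ
  · exact Set.ordConnected_Ioo

lemma law_bernoulli_eq {m : ℝ} (hm : m ∈ Set.Icc (0 : ℝ) 1) :
    bernoulli.law m =
      ENNReal.ofReal m • Measure.dirac 1 + ENNReal.ofReal (1 - m) • Measure.dirac 0 := by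
  have h : Set.projIcc (0 : ℝ) 1 zero_le_one m = ⟨m, hm⟩ := Set.projIcc_of_mem _ hm
  rw [law, h, bernoulliMeasure_def]
  congr 1
  · rw [ENNReal.smul_def]
    congr 1
    rw [ENNReal.ofReal, Real.toNNReal_of_nonneg hm.1]; rfl
  · rw [ENNReal.smul_def]
    congr 1
    rw [ENNReal.ofReal, Real.toNNReal_of_nonneg (by linarith [hm.2])]; rfl

instance (F : RewardFamily) (m : ℝ) : IsProbabilityMeasure (F.law m) := by
  cases F <;> · unfold law; infer_instance

lemma lintegral_law_bernoulli {m : ℝ} (hm : m ∈ Set.Icc (0 : ℝ) 1) (f : ℝ → ℝ≥0∞) :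
    ∫⁻ r, f r ∂bernoulli.law m = ENNReal.ofReal m * f 1 + ENNReal.ofReal (1 - m) * f 0 := by
  rw [law_bernoulli_eq hm]
  simp

lemma integral_law_bernoulli {m : ℝ} (hm : m ∈ Set.Icc (0 : ℝ) 1) (f : ℝ → ℝ) :
    ∫ r, f r ∂bernoulli.law m = m * f 1 + (1 - m) * f 0 := by
  have h : Set.projIcc (0 : ℝ) 1 zero_le_one m = ⟨m, hm⟩ := Set.projIcc_of_mem _ hm
  rw [law, h, integral_bernoulliMeasure]
  simp

lemma integrable_law_bernoulli (m : ℝ) (f : ℝ → ℝ) : Integrable f (bernoulli.law m) :=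
  integrable_bernoulliMeasure _ _ _ _

lemma integral_id_law {F : RewardFamily} {m : ℝ} (hm : m ∈ F.closedMeans) :
    ∫ r, r ∂F.law m = m := by
  cases F
  · exact integral_id_gaussianReal
  · rw [integral_law_bernoulli hm]; ring

/-- The closed forms of the divergence `KL(x | y)`: `(x - y)² / 2` for Gaussian laws, and
`x log (x / y) + (1 - x) log ((1 - x) / (1 - y))` for Bernoulli laws. -/
noncomputable def klReal : RewardFamily → ℝ → ℝ → ℝ
  | gaussian, x, y => (x - y) ^ 2 / 2
  | bernoulli, x, y => x * Real.log (x / y) + (1 - x) * Real.log ((1 - x) / (1 - y))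

lemma klDiv_eq_of_density {ν ρ : Measure ℝ} [IsProbabilityMeasure ν] [IsProbabilityMeasure ρ]
    {w : ℝ → ℝ} (hw : Measurable w) (hw0 : ∀ r, 0 ≤ w r)
    (h : ν = ρ.withDensity fun r => ENNReal.ofReal (w r))
    (hi : Integrable (fun r => Real.log (w r)) ν) :
    klDiv ν ρ = ENNReal.ofReal (∫ r, Real.log (w r) ∂ν) := by
  have hac : ν ≪ ρ := h ▸ withDensity_absolutelyContinuous _ _
  have hd : ν.rnDeriv ρ =ᵐ[ρ] fun r => ENNReal.ofReal (w r) := by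
    rw [h]; exact Measure.rnDeriv_withDensity _ hw.ennreal_ofReal
  have hl : llr ν ρ =ᵐ[ν] fun r => Real.log (w r) := by
    filter_upwards [hac.ae_le hd] with r hr
    simp [llr, hr, ENNReal.toReal_ofReal (hw0 r)]
  rw [klDiv_of_ac_of_integrable hac (hi.congr hl.symm), integral_congr_ae hl]
  simp

lemma gaussianReal_eq_withDensity (x y : ℝ) :
    gaussianReal x 1 = (gaussianReal y 1).withDensity
      fun r => ENNReal.ofReal (Real.exp ((x - y) * r - (x ^ 2 - y ^ 2) / 2)) := by
  rw [gaussianReal_of_var_ne_zero _ one_ne_zero, gaussianReal_of_var_ne_zero _ one_ne_zero,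
    ← withDensity_mul _ (measurable_gaussianPDF _ _) (by fun_prop)]
  congr 1
  ext r
  simp only [Pi.mul_apply, gaussianPDF]
  rw [← ENNReal.ofReal_mul (gaussianPDFReal_nonneg _ _ _), gaussianPDFReal, gaussianPDFReal,
    mul_assoc _ (Real.exp _) (Real.exp _), ← Real.exp_add]
  congr 3
  push_cast
  ring

lemma kl_eq_ofReal {F : RewardFamily} {x y : ℝ} (hx : x ∈ F.closedMeans) (hy : y ∈ F.means) :
    F.kl x y = ENNReal.ofReal (F.klReal x y) := by
  cases F
  · have hi : Integrable (fun r : ℝ => (x - y) * r - (x ^ 2 - y ^ 2) / 2) (gaussianReal x 1) :=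
      ((memLp_id_gaussianReal' 1 (by simp)).integrable le_rfl |>.const_mul _).sub
        (integrable_const _)
    rw [kl, law, law, klDiv_eq_of_density (by fun_prop) (fun _ => (Real.exp_pos _).le)
      (gaussianReal_eq_withDensity x y) (by simpa using hi)]
    congr 1
    simp only [Real.log_exp]
    have h1 : Integrable (fun r : ℝ => (x - y) * r) (gaussianReal x 1) :=
      ((memLp_id_gaussianReal' 1 (by simp)).integrable le_rfl).const_mul _
    rw [integral_sub h1 (integrable_const _), integral_const_mul, integral_id_gaussianReal]
    simp [klReal]
    ring
  · obtain ⟨hy0, hy1⟩ := hy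
    have hy1' : 0 < 1 - y := by linarith
    have h1 : 0 ≤ x / y := div_nonneg hx.1 hy0.le
    have h2 : 0 ≤ (1 - x) / (1 - y) := div_nonneg (by linarith [hx.2]) hy1'.le
    have hd : bernoulli.law x = (bernoulli.law y).withDensity
        fun r => ENNReal.ofReal (if r = 1 then x / y else (1 - x) / (1 - y)) := by
      ext B hB
      rw [withDensity_apply _ hB, ← lintegral_indicator hB, ← lintegral_indicator_one hB,
        lintegral_law_bernoulli hx, lintegral_law_bernoulli ⟨hy0.le, hy1.le⟩]
      by_cases h1B : (1 : ℝ) ∈ B <;> by_cases h0B : (0 : ℝ) ∈ B <;>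
        simp [h1B, h0B, ← ENNReal.ofReal_mul hy0.le, ← ENNReal.ofReal_mul hy1'.le,
          mul_div_cancel₀ _ hy0.ne', mul_div_cancel₀ _ hy1'.ne']
    have hm : Measurable fun r : ℝ => if r = 1 then x / y else (1 - x) / (1 - y) :=
      Measurable.ite (measurableSet_singleton 1) (by fun_prop) (by fun_prop)
    rw [kl, klDiv_eq_of_density hm (fun r => by split_ifs <;> assumption) hd
      (integrable_law_bernoulli _ _), integral_law_bernoulli hx]
    simp [klReal]

lemma kl_self (F : RewardFamily) (x : ℝ) : F.kl x x = 0 := klDiv_self _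

lemma kl_pos {F : RewardFamily} {x y : ℝ} (hx : x ∈ F.closedMeans) (hy : y ∈ F.closedMeans)
    (hxy : x ≠ y) : 0 < F.kl x y := by
  rw [pos_iff_ne_zero, kl, Ne, klDiv_eq_zero_iff]
  intro h
  apply hxy
  rw [← integral_id_law hx, h, integral_id_law hy]

/-- A Bernoulli law of mean less than `1` charges `0`, which the law of mean `1` does not. -/
lemma kl_bernoulli_one {x : ℝ} (hx : x ∈ Set.Ico (0 : ℝ) 1) : bernoulli.kl x 1 = ⊤ := by
  apply klDiv_of_not_ac
  intro h
  have h0 : bernoulli.law 1 {0} = 0 := by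
    rw [law_bernoulli_eq (by simp)]; simp
  have h1 := h h0
  rw [law_bernoulli_eq ⟨hx.1, hx.2.le⟩] at h1
  simp at h1
  linarith [hx.2]

lemma klReal_nonneg {F : RewardFamily} {x y : ℝ} (hx : x ∈ F.closedMeans) (hy : y ∈ F.means) :
    0 ≤ F.klReal x y := by
  cases F
  · simp only [klReal]; positivity
  · have key : ∀ u v : ℝ, 0 ≤ u → 0 < v → u - v ≤ u * Real.log (u / v) := by
      intro u v hu hv
      rcases hu.eq_or_lt with rfl | hu
      · simp [hv.le]
      · have := Real.one_sub_inv_le_log_of_pos (div_pos hu hv)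
        calc u - v = u * (1 - (u / v)⁻¹) := by field_simp
          _ ≤ _ := by gcongr
    have h1 := key x y hx.1 hy.1
    have h2 := key (1 - x) (1 - y) (by linarith [hx.2]) (by linarith [hy.2])
    simp only [klReal]; linarith

lemma mul_log_div (x : ℝ) {y : ℝ} (hy : 0 < y) :
    x * Real.log (x / y) = x * Real.log x - x * Real.log y := by
  rcases eq_or_ne x 0 with rfl | hx
  · simp
  · rw [Real.log_div hx hy.ne']; ring

/-- A reverse Pythagorean inequality: along the real line, divergences are superadditive. -/
lemma klReal_add_le {F : RewardFamily} {x y z : ℝ} (hx : x ∈ F.closedMeans) (hy : y ∈ F.means)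
    (hz : z ∈ F.means) (hxy : x ≤ y) (hyz : y ≤ z) :
    F.klReal x y + F.klReal y z ≤ F.klReal x z := by
  cases F
  · simp only [klReal]; nlinarith [mul_nonneg (sub_nonneg.2 hxy) (sub_nonneg.2 hyz)]
  · obtain ⟨hy0, hy1⟩ := hy
    obtain ⟨hz0, hz1⟩ := hz
    have hl1 := Real.log_le_log hy0 hyz
    have hl2 := Real.log_le_log (by linarith : 0 < 1 - z) (by linarith : 1 - z ≤ 1 - y)
    simp only [klReal]
    rw [mul_log_div x hy0, mul_log_div x hz0, mul_log_div y hz0,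
      mul_log_div _ (y := 1 - y) (by linarith), mul_log_div _ (y := 1 - z) (by linarith),
      mul_log_div _ (y := 1 - z) (by linarith)]
    nlinarith [mul_nonneg (sub_nonneg.2 hxy) (sub_nonneg.2 hl1),
      mul_nonneg (sub_nonneg.2 hxy) (sub_nonneg.2 hl2)]

/-- Superadditivity extends to the closed range of means. Both monotonicity properties of the
divergence follow from it. -/
lemma kl_add_le {F : RewardFamily} {x y z : ℝ} (hx : x ∈ F.closedMeans) (hz : z ∈ F.closedMeans)
    (hxy : x ≤ y) (hyz : y ≤ z) : F.kl x y + F.kl y z ≤ F.kl x z := by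
  rcases hxy.eq_or_lt with rfl | hxy'
  · simp [kl_self]
  rcases hyz.eq_or_lt with rfl | hyz'
  · simp [kl_self]
  have hy : y ∈ F.means := by
    cases F
    · trivial
    · exact ⟨hx.1.trans_lt hxy', hyz'.trans_le hz.2⟩
  by_cases hz' : z ∈ F.means
  · rw [kl_eq_ofReal hx hy, kl_eq_ofReal (F.means_subset_closedMeans hy) hz', kl_eq_ofReal hx hz',
      ← ENNReal.ofReal_add (klReal_nonneg hx hy)
        (klReal_nonneg (F.means_subset_closedMeans hy) hz')]
    exact ENNReal.ofReal_le_ofReal (klReal_add_le hx hy hz' hxy hyz)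
  · cases F
    · exact absurd trivial hz'
    · have : z = 1 := le_antisymm hz.2 <| not_lt.1 fun h1 =>
        hz' ⟨(hx.1.trans_lt hxy').trans hyz', h1⟩
      rw [this, kl_bernoulli_one ⟨hx.1, hxy'.trans hy.2⟩]
      exact le_top

lemma kl_le_kl_right {F : RewardFamily} {x y z : ℝ} (hx : x ∈ F.closedMeans)
    (hz : z ∈ F.closedMeans) (hxy : x ≤ y) (hyz : y ≤ z) : F.kl x y ≤ F.kl x z :=
  le_self_add.trans (kl_add_le hx hz hxy hyz)

lemma kl_le_kl_left {F : RewardFamily} {x y z : ℝ} (hx : x ∈ F.closedMeans)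
    (hz : z ∈ F.closedMeans) (hxy : x ≤ y) (hyz : y ≤ z) : F.kl y z ≤ F.kl x z :=
  le_add_self.trans (kl_add_le hx hz hxy hyz)

lemma kl_le_kl {F : RewardFamily} {w x y z : ℝ} (hw : w ∈ F.closedMeans) (hz : z ∈ F.closedMeans)
    (hwx : w ≤ x) (hxy : x ≤ y) (hyz : y ≤ z) (hx : x ∈ F.closedMeans) :
    F.kl x y ≤ F.kl w z :=
  (kl_le_kl_right hx hz hxy hyz).trans (kl_le_kl_left hw hz hwx (hxy.trans hyz))

lemma kl_ne_top {F : RewardFamily} {x y : ℝ} (hx : x ∈ F.closedMeans) (hy : y ∈ F.means) :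
    F.kl x y ≠ ⊤ := by
  rw [kl_eq_ofReal hx hy]; exact ENNReal.ofReal_ne_top

lemma toReal_kl {F : RewardFamily} {x y : ℝ} (hx : x ∈ F.closedMeans) (hy : y ∈ F.means) :
    (F.kl x y).toReal = F.klReal x y := by
  rw [kl_eq_ofReal hx hy, ENNReal.toReal_ofReal (klReal_nonneg hx hy)]

lemma toReal_kl_pos {F : RewardFamily} {x y : ℝ} (hx : x ∈ F.closedMeans) (hy : y ∈ F.means)
    (hxy : x ≠ y) : 0 < (F.kl x y).toReal :=
  ENNReal.toReal_pos (kl_pos hx (F.means_subset_closedMeans hy) hxy).ne' (kl_ne_top hx hy)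

/-- Both families are sub-Gaussian, with variance proxy `1` in the Gaussian case and `1 / 4` in the
Bernoulli case (Hoeffding's lemma). -/
lemma hasSubgaussianMGF_law {F : RewardFamily} {m : ℝ} (hm : m ∈ F.closedMeans) :
    HasSubgaussianMGF (fun r => r - m) (match F with | gaussian => 1 | bernoulli => 1 / 4)
      (F.law m) := by
  cases F
  · refine ⟨fun t => ?_, fun t => ?_⟩
    · simp only [mul_sub, Real.exp_sub]
      exact (integrable_exp_mul_gaussianReal t).div_const _
    · simp only [law]
      rw [mgf_gaussianReal (gaussianReal_map_sub_const m)]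
      simp
  · have h : ∀ᵐ r ∂bernoulli.law m, r ∈ Set.Icc (0 : ℝ) 1 := by
      rw [law_bernoulli_eq hm, ae_add_measure_iff]
      constructor <;>
      · refine Measure.ae_smul_measure ?_ _
        simp [ae_dirac_eq]
    have := hasSubgaussianMGF_of_mem_Icc (X := fun r : ℝ => r) aemeasurable_id h
    rw [integral_id_law (F := bernoulli) hm] at this
    convert this using 1
    ext; norm_num

end RewardFamily

/-! ### Pull counts -/

section Pulls

variable {A : Type*} [DecidableEq A]

/-- The times among `1, …, t` at which arm `a` is pulled. -/
def pullTimes (arm : ℕ → A) (t : ℕ) (a : A) : Finset ℕ :=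
  (Finset.Icc 1 t).filter (fun s => arm s = a)

lemma pullTimes_zero (arm : ℕ → A) (a : A) : pullTimes arm 0 a = ∅ := by
  simp [pullTimes]

lemma pullTimes_succ (arm : ℕ → A) (t : ℕ) (a : A) :
    pullTimes arm (t + 1) a =
      if arm (t + 1) = a then insert (t + 1) (pullTimes arm t a) else pullTimes arm t a := by
  rw [pullTimes, ← Finset.insert_Icc_right_eq_Icc_add_one (by omega : 1 ≤ t + 1),
    Finset.filter_insert]
  rfl

lemma notMem_pullTimes (arm : ℕ → A) (t : ℕ) (a : A) : t + 1 ∉ pullTimes arm t a := by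
  simp [pullTimes]

lemma card_pullTimes (arm : ℕ → A) (t : ℕ) (a : A) : (pullTimes arm t a).card = pulls arm t a := rfl

lemma pulls_zero (arm : ℕ → A) (a : A) : pulls arm 0 a = 0 := by simp [pulls]

lemma pulls_succ (arm : ℕ → A) (t : ℕ) (a : A) :
    pulls arm (t + 1) a = pulls arm t a + if arm (t + 1) = a then 1 else 0 := by
  rw [← card_pullTimes, ← card_pullTimes, pullTimes_succ]
  split_ifs
  · rw [Finset.card_insert_of_notMem (notMem_pullTimes arm t a)]
  · rfl

lemma pulls_mono (arm : ℕ → A) (a : A) : Monotone fun t => pulls arm t a :=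
  monotone_nat_of_le_succ fun t => by rw [pulls_succ]; omega

lemma pulls_le (arm : ℕ → A) (t : ℕ) (a : A) : pulls arm t a ≤ t := by
  refine (Finset.card_filter_le _ _).trans ?_
  simp

lemma pulls_mul_empMean (arm : ℕ → A) (x : ℕ → ℝ) (t : ℕ) (a : A) :
    pulls arm t a * empMean arm x t a = ∑ s ∈ pullTimes arm t a, x s := by
  rcases Nat.eq_zero_or_pos (pulls arm t a) with h | h
  · have : pullTimes arm t a = ∅ := Finset.card_eq_zero.1 h
    rw [h, this]; simp
  · rw [empMean, mul_div_cancel₀ _ (by positivity)]; rfl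

/-- The last pull of an arm that has been pulled. -/
lemma exists_last_pull (arm : ℕ → A) (a : A) (t : ℕ) (h : 1 ≤ pulls arm t a) :
    ∃ s < t, arm (s + 1) = a ∧ pulls arm s a + 1 = pulls arm t a := by
  induction t with
  | zero => simp [pulls_zero] at h
  | succ t ih =>
    by_cases ht : arm (t + 1) = a
    · exact ⟨t, by omega, ht, by rw [pulls_succ, if_pos ht]⟩
    · rw [pulls_succ, if_neg ht] at h ⊢
      obtain ⟨s, hs, h1, h2⟩ := ih h
      exact ⟨s, by omega, h1, h2⟩

end Pulls

/-! ### A maximal inequality for bandit runs -/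

namespace IsBanditRun

variable {A Ω : Type*} {mΩ : MeasurableSpace Ω} {P : Measure Ω}
  {ℱ : Filtration ℕ mΩ} {ν : A → Measure ℝ} {arm : ℕ → Ω → A} {X : ℕ → Ω → ℝ}

lemma measurable_reward (h : IsBanditRun P ℱ ν arm X) (t : ℕ) : Measurable (X (t + 1)) :=
  (h.reward_observed t).mono (ℱ.le _) le_rfl

section Weight

variable [DecidableEq A]

/-- The product of the weights `w` over the rewards of arm `a` up to time `t`. -/
noncomputable def weight (arm : ℕ → Ω → A) (X : ℕ → Ω → ℝ) (w : ℝ → ℝ≥0∞) (a : A) (t : ℕ)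
    (ω : Ω) : ℝ≥0∞ :=
  ∏ s ∈ pullTimes (fun s => arm s ω) t a, w (X s ω)

lemma weight_succ (arm : ℕ → Ω → A) (X : ℕ → Ω → ℝ) (w : ℝ → ℝ≥0∞) (a : A) (t : ℕ) (ω : Ω) :
    weight arm X w a (t + 1) ω =
      if arm (t + 1) ω = a then weight arm X w a t ω * w (X (t + 1) ω)
      else weight arm X w a t ω := by
  unfold weight
  rw [pullTimes_succ]
  split_ifs
  · rw [Finset.prod_insert (notMem_pullTimes _ t a), mul_comm]
  · rfl

lemma measurable_weight (h : IsBanditRun P ℱ ν arm X) {w : ℝ → ℝ≥0∞} (hw : Measurable w) (a : A)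
    (t : ℕ) : Measurable[ℱ t] (weight arm X w a t) := by
  induction t with
  | zero =>
    have : weight arm X w a 0 = fun _ => 1 := by
      ext ω; simp [weight, pullTimes_zero]
    rw [this]; exact measurable_const
  | succ t ih =>
    have e : weight arm X w a (t + 1) = fun ω =>
        if arm (t + 1) ω = a then weight arm X w a t ω * w (X (t + 1) ω)
        else weight arm X w a t ω := funext fun ω => weight_succ arm X w a t ω
    rw [e]
    have hle := ℱ.mono (Nat.le_succ t)
    have ih' := ih.mono hle le_rfl
    exact Measurable.ite (hle _ (h.arm_past t a))
      (ih'.mul (hw.comp (h.reward_observed t))) ih'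

end Weight

variable [IsProbabilityMeasure P]

/-- On an event of the past on which arm `a` is pulled next, the next reward is distributed
according to `ν a`. -/
lemma map_restrict_eq [∀ a, IsProbabilityMeasure (ν a)] (h : IsBanditRun P ℱ ν arm X) (t : ℕ)
    (a : A) {D : Set Ω} (hD : MeasurableSet[ℱ t] D) (hDa : ∀ ω ∈ D, arm (t + 1) ω = a) :
    (P.restrict D).map (X (t + 1)) = P D • ν a := by
  ext B hB
  have hX := h.measurable_reward t
  have hDm : MeasurableSet D := ℱ.le t _ hD
  rw [Measure.map_apply hX hB, Measure.restrict_apply (hX hB), Measure.smul_apply, smul_eq_mul]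
  have hi : Integrable ((X (t + 1) ⁻¹' B).indicator fun _ => (1 : ℝ)) P :=
    (integrable_const _).indicator (hX hB)
  have h1 := setIntegral_condExp (ℱ.le t) hi hD
  rw [setIntegral_congr_ae (g := fun _ => (ν a).real B) hDm, setIntegral_const,
    setIntegral_indicator (hX hB), setIntegral_const] at h1
  · simp only [smul_eq_mul, mul_one] at h1
    rw [Set.inter_comm, ← ENNReal.toReal_eq_toReal_iff' (measure_ne_top _ _)
      (ENNReal.mul_ne_top (measure_ne_top _ _) (measure_ne_top _ _)), ENNReal.toReal_mul]
    exact h1.symm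
  · filter_upwards [h.reward_law t B hB] with ω hω hωD
    rw [hω, hDa ω hωD]

/-- Given the past, a reward of arm `a` is independent of the past with law `ν a`. -/
lemma setLIntegral_mul_reward [∀ a, IsProbabilityMeasure (ν a)] (h : IsBanditRun P ℱ ν arm X)
    (t : ℕ) (a : A) {D : Set Ω} (hD : MeasurableSet[ℱ t] D) (hDa : ∀ ω ∈ D, arm (t + 1) ω = a)
    {w : ℝ → ℝ≥0∞} (hw : Measurable w) {f : Ω → ℝ≥0∞} (hf : Measurable[ℱ t] f) :
    ∫⁻ ω in D, f ω * w (X (t + 1) ω) ∂P = (∫⁻ ω in D, f ω ∂P) * ∫⁻ r, w r ∂ν a := by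
  have hwX : Measurable fun ω => w (X (t + 1) ω) := hw.comp (h.measurable_reward t)
  refine @Measurable.ennreal_induction Ω (ℱ t) (fun f =>
    ∫⁻ ω in D, f ω * w (X (t + 1) ω) ∂P = (∫⁻ ω in D, f ω ∂P) * ∫⁻ r, w r ∂ν a) ?_ ?_ ?_ f hf
  · intro c s hs
    have hsm : MeasurableSet s := ℱ.le t _ hs
    have e : ∀ ω, s.indicator (fun _ => c) ω * w (X (t + 1) ω)
        = s.indicator (fun ω => c * w (X (t + 1) ω)) ω := fun ω => by
      by_cases hω : ω ∈ s <;> simp [hω]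
    simp only [e]
    rw [setLIntegral_indicator hsm, setLIntegral_indicator hsm, setLIntegral_const,
      lintegral_const_mul _ hwX, ← lintegral_map hw (h.measurable_reward t),
      h.map_restrict_eq t a (hs.inter hD) (fun ω hω => hDa ω hω.2), lintegral_smul_measure,
      smul_eq_mul, mul_assoc]
  · intro f g _ hf' hg' hf hg
    have hfm : Measurable f := hf'.mono (ℱ.le t) le_rfl
    simp only [Pi.add_apply, add_mul]
    rw [lintegral_add_left (f := fun ω => f ω * w (X (t + 1) ω)) (hfm.mul hwX),
      lintegral_add_left hfm, hf, hg, add_mul]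
  · intro f hf' hmono ih
    have hfm : ∀ n, Measurable (f n) := fun n => (hf' n).mono (ℱ.le t) le_rfl
    simp only [ENNReal.iSup_mul]
    rw [lintegral_iSup (f := fun n ω => f n ω * w (X (t + 1) ω)) (fun n => (hfm n).mul hwX)
      (fun i j hij ω => by dsimp only; gcongr; exact hmono hij ω), lintegral_iSup hfm hmono,
      ENNReal.iSup_mul]
    exact iSup_congr ih

/-- Almost surely all rewards lie in a set that carries the laws of all arms. -/
lemma ae_forall_reward_mem [∀ a, IsProbabilityMeasure (ν a)] (h : IsBanditRun P ℱ ν arm X)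
    {B : Set ℝ} (hB : MeasurableSet B) (hν : ∀ a, ν a B = 1) :
    ∀ᵐ ω ∂P, ∀ t, X (t + 1) ω ∈ B := by
  rw [ae_all_iff]
  intro t
  have hX := h.measurable_reward t
  have hi : Integrable ((X (t + 1) ⁻¹' B).indicator fun _ => (1 : ℝ)) P :=
    (integrable_const _).indicator (hX hB)
  have h1 := integral_condExp (ℱ.le t) (f := (X (t + 1) ⁻¹' B).indicator fun _ => (1 : ℝ))
    (μ := P)
  rw [integral_congr_ae (h.reward_law t B hB), integral_indicator (hX hB)] at h1
  simp [Measure.real, hν] at h1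
  have h2 : P (X (t + 1) ⁻¹' B) = 1 := by
    rw [← ENNReal.toReal_eq_one_iff]; exact h1.symm
  exact (prob_compl_eq_zero_iff (hX hB)).2 h2

variable [DecidableEq A]

lemma setLIntegral_weight_succ_le [∀ a, IsProbabilityMeasure (ν a)] (h : IsBanditRun P ℱ ν arm X)
    {w : ℝ → ℝ≥0∞} (hw : Measurable w) {a : A} (ha : ∫⁻ r, w r ∂ν a ≤ 1) (t : ℕ) {D : Set Ω}
    (hD : MeasurableSet[ℱ t] D) :
    ∫⁻ ω in D, weight arm X w a (t + 1) ω ∂P ≤ ∫⁻ ω in D, weight arm X w a t ω ∂P := by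
  set E := {ω | arm (t + 1) ω = a}
  have hE : MeasurableSet[ℱ t] E := h.arm_past t a
  have hEm : MeasurableSet E := ℱ.le t _ hE
  have hDm : MeasurableSet D := ℱ.le t _ hD
  rw [← lintegral_inter_add_sdiff _ D hEm, ← lintegral_inter_add_sdiff _ D hEm]
  refine add_le_add ?_ (le_of_eq ?_)
  · rw [setLIntegral_congr_fun (g := fun ω => weight arm X w a t ω * w (X (t + 1) ω))
      (hDm.inter hEm) (fun ω hω => by rw [weight_succ]; exact if_pos hω.2),
      h.setLIntegral_mul_reward t a (hD.inter hE) (fun ω hω => hω.2) hw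
        (h.measurable_weight hw a t)]
    exact mul_le_of_le_one_right' ha
  · exact setLIntegral_congr_fun (hDm.diff hEm)
      (fun ω hω => by rw [weight_succ]; exact if_neg hω.2)

/-- Ville's inequality: if the weight `w` has mean at most one under `ν a`, then the product of the
weights of the rewards of arm `a` is a nonnegative supermartingale that starts at one, and it
exceeds `c` at some time with probability at most `1 / c`. -/
lemma mul_measure_exists_le_weight [∀ a, IsProbabilityMeasure (ν a)]
    (h : IsBanditRun P ℱ ν arm X) {w : ℝ → ℝ≥0∞} (hw : Measurable w) {a : A}
    (ha : ∫⁻ r, w r ∂ν a ≤ 1) (c : ℝ≥0∞) :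
    c * P {ω | ∃ t, c ≤ weight arm X w a t ω} ≤ 1 := by
  set R : ℕ → Set Ω := fun t => {ω | ∃ s ≤ t, c ≤ weight arm X w a s ω}
  have hRm : ∀ t, MeasurableSet[ℱ t] (R t) := by
    intro t
    have : R t = ⋃ s ∈ Finset.range (t + 1), {ω | c ≤ weight arm X w a s ω} := by
      ext ω; simp [R]
    rw [this]
    refine Finset.measurableSet_biUnion _ fun s hs => ?_
    refine ℱ.mono (Nat.lt_succ_iff.1 (Finset.mem_range.1 hs)) _ ?_
    exact h.measurable_weight hw a s measurableSet_Ici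
  have hmono : Monotone R := fun t t' htt' ω ⟨s, hs, hc⟩ => ⟨s, hs.trans htt', hc⟩
  -- The process stopped when it first exceeds `c` keeps an integral of at most one.
  have key : ∀ t, c * P (R t) + ∫⁻ ω in (R t)ᶜ, weight arm X w a t ω ∂P ≤ 1 := by
    have gain : ∀ (t : ℕ) (D : Set Ω), MeasurableSet D →
        c * P (D ∩ {ω | c ≤ weight arm X w a t ω})
          + ∫⁻ ω in D \ {ω | c ≤ weight arm X w a t ω}, weight arm X w a t ω ∂P
          ≤ ∫⁻ ω in D, weight arm X w a t ω ∂P := by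
      intro t D hD
      have hm : MeasurableSet {ω | c ≤ weight arm X w a t ω} :=
        measurableSet_le measurable_const ((h.measurable_weight hw a t).mono (ℱ.le t) le_rfl)
      rw [← lintegral_inter_add_sdiff (weight arm X w a t) D hm, ← setLIntegral_const]
      exact add_le_add (setLIntegral_mono' (hD.inter hm) fun ω hω => hω.2) le_rfl
    intro t
    induction t with
    | zero =>
      have h0 := gain 0 Set.univ MeasurableSet.univ
      have e : R 0 = {ω | c ≤ weight arm X w a 0 ω} := by ext ω; simp [R]
      rw [e, Set.compl_eq_univ_sdiff]
      rw [Set.univ_inter] at h0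
      refine h0.trans ?_
      simp [weight, pullTimes_zero]
    | succ t ih =>
      have h1 := gain (t + 1) (R t)ᶜ (ℱ.le t _ (hRm t)).compl
      have h2 := h.setLIntegral_weight_succ_le hw ha t (hRm t).compl
      have e : R (t + 1) = R t ∪ ((R t)ᶜ ∩ {ω | c ≤ weight arm X w a (t + 1) ω}) := by
        ext ω
        constructor
        · rintro ⟨s, hs, hc⟩
          by_cases hω : ω ∈ R t
          · exact Or.inl hω
          · rcases hs.lt_or_eq with hs | rfl
            · exact Or.inl ⟨s, Nat.lt_succ_iff.1 hs, hc⟩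
            · exact Or.inr ⟨hω, hc⟩
        · rintro (hω | hω)
          · exact hmono (Nat.le_succ t) hω
          · exact ⟨t + 1, le_rfl, hω.2⟩
      have e' : (R (t + 1))ᶜ = (R t)ᶜ \ {ω | c ≤ weight arm X w a (t + 1) ω} := by
        rw [e]; ext ω; simp; tauto
      calc c * P (R (t + 1)) + ∫⁻ ω in (R (t + 1))ᶜ, weight arm X w a (t + 1) ω ∂P
          ≤ c * (P (R t) + P ((R t)ᶜ ∩ {ω | c ≤ weight arm X w a (t + 1) ω}))
            + ∫⁻ ω in (R t)ᶜ \ {ω | c ≤ weight arm X w a (t + 1) ω},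
                weight arm X w a (t + 1) ω ∂P := by
            rw [e', e]; gcongr; exact measure_union_le _ _
        _ ≤ c * P (R t) + ∫⁻ ω in (R t)ᶜ, weight arm X w a (t + 1) ω ∂P := by
            rw [mul_add, add_assoc]; gcongr
        _ ≤ _ := (add_le_add le_rfl h2).trans ih
  have e : {ω | ∃ t, c ≤ weight arm X w a t ω} = ⋃ t, R t := by
    ext ω
    simp only [R, Set.mem_ofPred_eq, Set.mem_iUnion]
    exact ⟨fun ⟨t, ht⟩ => ⟨t, t, le_rfl, ht⟩, fun ⟨_, s, _, hs⟩ => ⟨s, hs⟩⟩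
  rw [e, hmono.measure_iUnion, ENNReal.mul_iSup]
  exact iSup_le fun t => le_self_add.trans (key t)

/-- Exponential form of Ville's inequality. -/
lemma measure_le_of_exp_le_weight [∀ a, IsProbabilityMeasure (ν a)]
    (h : IsBanditRun P ℱ ν arm X) {w : ℝ → ℝ≥0∞} (hw : Measurable w) {a : A}
    (ha : ∫⁻ r, w r ∂ν a ≤ 1) (z : ℝ) {E : Set Ω}
    (hE : ∀ ω ∈ E, ∃ t, ENNReal.ofReal (Real.exp z) ≤ weight arm X w a t ω) :
    P E ≤ ENNReal.ofReal (Real.exp (-z)) := by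
  have h1 := h.mul_measure_exists_le_weight hw ha (ENNReal.ofReal (Real.exp z))
  rw [Real.exp_neg, ENNReal.ofReal_inv_of_pos (Real.exp_pos z)]
  refine (measure_mono hE).trans ?_
  rw [ENNReal.le_inv_iff_mul_le, mul_comm]
  exact h1

end IsBanditRun

/-! ### Deviations of empirical means -/

/-- Some arm has an empirical mean that deviates by at least `ε` from its mean after `n` pulls or
more. -/
def Unreliable {A : Type*} [DecidableEq A] (μ : A → ℝ) (ε : ℝ) (arm : ℕ → A) (x : ℕ → ℝ)
    (n : ℕ) : Prop :=
  ∃ t a, n ≤ pulls arm t a ∧ ε ≤ |empMean arm x t a - μ a|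

/-- Some arm `a` for which `μ a - ε` is a mean of the family has at some time an empirical mean
below `μ a - ε`, and its index relative to `μ a - ε` is at least `log n`. -/
def Underrated {A : Type*} [DecidableEq A] (F : RewardFamily) (μ : A → ℝ) (ε : ℝ) (arm : ℕ → A)
    (x : ℕ → ℝ) (n : ℕ) : Prop :=
  ∃ a, μ a - ε ∈ F.means ∧ ∃ t, empMean arm x t a < μ a - ε ∧
    ENNReal.log (n : ℝ≥0∞) ≤ indexWith arm t a (F.kl (empMean arm x t a) (μ a - ε))

lemma RewardFamily.lintegral_exp_law_le {F : RewardFamily} {m : ℝ} (hm : m ∈ F.closedMeans)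
    (l : ℝ) : ∫⁻ r, ENNReal.ofReal (Real.exp (l * (r - m) - l ^ 2 / 2)) ∂F.law m ≤ 1 := by
  have h := RewardFamily.hasSubgaussianMGF_law hm
  have hi := h.integrable_exp_mul l
  have hle := h.mgf_le l
  simp only [Real.exp_sub]
  rw [← ofReal_integral_eq_lintegral_ofReal (hi.div_const _)
    (ae_of_all _ fun r => by positivity), integral_div, ENNReal.ofReal_le_one,
    div_le_one (Real.exp_pos _)]
  refine hle.trans (Real.exp_le_exp.2 ?_)
  cases F
  · simp
  · simp; nlinarith [sq_nonneg l]

lemma sum_exp_neg_mul_le {u : ℝ} (hu : 0 < u) (T : ℕ) :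
    ∑ n ∈ Finset.Icc 1 T, Real.exp (-(n * u)) ≤ 1 / u := by
  have hq : Real.exp (-u) < 1 := by simpa using hu
  have e : ∀ n : ℕ, Real.exp (-(n * u)) = Real.exp (-u) ^ n := fun n => by
    rw [← Real.exp_nat_mul]; ring_nf
  simp only [e]
  rw [← Finset.Ico_add_one_right_eq_Icc, geom_sum_Ico hq.ne (by omega)]
  have h1 : u + 1 ≤ Real.exp u := Real.add_one_le_exp u
  have h2 : Real.exp (-u) * Real.exp u = 1 := by rw [← Real.exp_add]; simp
  have h3 : 0 < Real.exp (-u) := Real.exp_pos _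
  rw [← neg_div_neg_eq, div_le_div_iff₀ (by linarith) hu]
  have h4 : 0 ≤ Real.exp (-u) ^ (T + 1) := by positivity
  nlinarith [mul_nonneg h4 hu.le, mul_le_mul_of_nonneg_left h1 h3.le]

/-- If every event `U n` is covered by the events `E i` with `n ≤ W i`, and `p i` bounds the
probability of `E i`, then the probabilities of the `U n` add up to at most `∑ W i * p i`, because
`E i` is used for at most `W i` values of `n`. -/
lemma sum_measure_le_tsum {Ω ι : Type*} {mΩ : MeasurableSpace Ω} {P : Measure Ω} [Countable ι]
    {U : ℕ → Set Ω} {E : ι → Set Ω} {W p : ι → ℝ} (hW : ∀ i, 0 ≤ W i)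
    (hU : ∀ᵐ ω ∂P, ∀ n, 1 ≤ n → ω ∈ U n → ∃ i, ω ∈ E i ∧ n ≤ W i)
    (hp : ∀ i, 0 < W i → P (E i) ≤ ENNReal.ofReal (p i)) (T : ℕ) :
    ∑ n ∈ Finset.Icc 1 T, P (U n) ≤ ∑' i, ENNReal.ofReal (W i * p i) := by
  classical
  have h1 : ∀ n ∈ Finset.Icc 1 T, P (U n) ≤ ∑' i, if (n : ℝ) ≤ W i then P (E i) else 0 := by
    intro n hn
    calc P (U n) ≤ P (⋃ i, if (n : ℝ) ≤ W i then E i else ∅) := by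
          apply measure_mono_ae
          filter_upwards [hU] with ω hω hωU
          obtain ⟨i, hi, hni⟩ := hω n (Finset.mem_Icc.1 hn).1 hωU
          exact Set.mem_iUnion.2 ⟨i, by rwa [if_pos hni]⟩
      _ ≤ ∑' i, P (if (n : ℝ) ≤ W i then E i else ∅) := measure_iUnion_le _
      _ = _ := tsum_congr fun i => by split_ifs <;> simp
  refine (Finset.sum_le_sum h1).trans ?_
  rw [← Summable.tsum_finsetSum (fun _ _ => ENNReal.summable)]
  refine ENNReal.tsum_le_tsum fun i => ?_
  rw [← Finset.sum_filter, Finset.sum_const, nsmul_eq_mul]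
  have hc : ((Finset.Icc 1 T).filter fun n : ℕ => (n : ℝ) ≤ W i).card ≤ ⌊W i⌋₊ := by
    have : (Finset.Icc 1 T).filter (fun n : ℕ => (n : ℝ) ≤ W i) ⊆ Finset.Icc 1 ⌊W i⌋₊ := by
      intro n hn
      simp only [Finset.mem_filter, Finset.mem_Icc] at hn ⊢
      exact ⟨hn.1.1, Nat.le_floor hn.2⟩
    simpa using Finset.card_le_card this
  rcases (hW i).eq_or_lt with h0 | h0
  · rw [← h0] at hc
    rw [Nat.floor_zero, Nat.le_zero] at hc
    rw [← h0, hc]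
    simp
  · have hc' : ((((Finset.Icc 1 T).filter fun n : ℕ => (n : ℝ) ≤ W i).card : ℕ) : ℝ≥0∞)
        ≤ ENNReal.ofReal (W i) := by
      rw [← ENNReal.ofReal_natCast]
      exact ENNReal.ofReal_le_ofReal ((Nat.cast_le.2 hc).trans (Nat.floor_le (hW i)))
    rw [ENNReal.ofReal_mul (hW i)]
    exact mul_le_mul' hc' (hp i h0)

section Index

variable {A : Type*} [DecidableEq A]

lemma indexWith_eq_bot {arm : ℕ → A} {t : ℕ} {a : A} (h : pulls arm t a = 0) (k : ℝ≥0∞) :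
    indexWith arm t a k = ⊥ := by
  simp [indexWith, h]

lemma log_pulls_le_indexWith (arm : ℕ → A) (t : ℕ) (a : A) (k : ℝ≥0∞) :
    ENNReal.log (pulls arm t a) ≤ indexWith arm t a k :=
  le_add_of_nonneg_left (EReal.coe_ennreal_nonneg _)

lemma indexWith_zero (arm : ℕ → A) (t : ℕ) (a : A) :
    indexWith arm t a 0 = ENNReal.log (pulls arm t a) := by
  simp [indexWith]

lemma indexWith_mono (arm : ℕ → A) (t : ℕ) (a : A) : Monotone (indexWith arm t a) := by
  intro k k' h
  refine add_le_add (EReal.coe_ennreal_le_coe_ennreal_iff.2 ?_) le_rfl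
  gcongr

lemma indexWith_ofReal {arm : ℕ → A} {t : ℕ} {a : A} (h : 1 ≤ pulls arm t a) {κ : ℝ} (hκ : 0 ≤ κ) :
    indexWith arm t a (ENNReal.ofReal κ)
      = ((pulls arm t a * κ + Real.log (pulls arm t a) : ℝ) : EReal) := by
  have h0 : (0 : ℝ) < pulls arm t a := by exact_mod_cast h
  rw [indexWith, ← ENNReal.ofReal_natCast, ← ENNReal.ofReal_mul h0.le,
    EReal.coe_ennreal_ofReal, ENNReal.log_ofReal_of_pos h0, max_eq_left (by positivity)]
  norm_cast

lemma log_natCast {n : ℕ} (h : 1 ≤ n) : ENNReal.log (n : ℝ≥0∞) = (Real.log n : EReal) := by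
  rw [← ENNReal.ofReal_natCast, ENNReal.log_ofReal_of_pos (by exact_mod_cast h)]

lemma le_mul_exp_of_log_le_indexWith {arm : ℕ → A} {t n : ℕ} {a : A} (hn : 1 ≤ n) {κ : ℝ}
    (hκ : 0 ≤ κ) (h : ENNReal.log (n : ℝ≥0∞) ≤ indexWith arm t a (ENNReal.ofReal κ)) :
    1 ≤ pulls arm t a ∧ (n : ℝ) ≤ pulls arm t a * Real.exp (pulls arm t a * κ) := by
  have h1 : 1 ≤ pulls arm t a := by
    by_contra h0
    rw [indexWith_eq_bot (by omega), le_bot_iff, ENNReal.log_eq_bot_iff] at h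
    simp at h; omega
  refine ⟨h1, ?_⟩
  have h0 : (0 : ℝ) < pulls arm t a := by exact_mod_cast h1
  rw [indexWith_ofReal h1 hκ, log_natCast hn, EReal.coe_le_coe_iff] at h
  have hn' : (0 : ℝ) < n := by exact_mod_cast hn
  rw [← Real.exp_log hn', mul_comm]
  nth_rw 2 [← Real.exp_log h0]
  rw [← Real.exp_add]
  exact Real.exp_le_exp.2 h

end Index

namespace IsBanditRun

variable {A Ω : Type*} [DecidableEq A] {mΩ : MeasurableSpace Ω} {P : Measure Ω}
  [IsProbabilityMeasure P] {ℱ : Filtration ℕ mΩ} {F : RewardFamily} {μ : A → ℝ}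
  {arm : ℕ → Ω → A} {X : ℕ → Ω → ℝ}

lemma weight_exp (arm : ℕ → Ω → A) (X : ℕ → Ω → ℝ) (l m c : ℝ) (a : A) (t : ℕ) (ω : Ω) :
    weight arm X (fun r => ENNReal.ofReal (Real.exp (l * (r - m) - c))) a t ω =
      ENNReal.ofReal (Real.exp (pulls (fun s => arm s ω) t a *
        (l * (empMean (fun s => arm s ω) (fun s => X s ω) t a - m) - c))) := by
  rw [weight, ← ENNReal.ofReal_prod_of_nonneg (fun _ _ => (Real.exp_pos _).le), ← Real.exp_sum]
  congr 2
  rw [Finset.sum_sub_distrib, ← Finset.mul_sum, Finset.sum_sub_distrib, Finset.sum_const,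
    Finset.sum_const, card_pullTimes, ← pulls_mul_empMean]
  simp only [nsmul_eq_mul]
  ring

/-- Chernoff bound, uniform over all numbers of pulls beyond `n`. -/
lemma measure_exists_mul_deviation_ge_le (h : IsBanditRun P ℱ (fun a => F.law (μ a)) arm X) {a : A}
    (ha : μ a ∈ F.closedMeans) (n : ℕ) {s z : ℝ} (hs : s ^ 2 = 1) (hz : 0 ≤ z) :
    P {ω | ∃ t, n ≤ pulls (fun s => arm s ω) t a ∧
      z ≤ s * (empMean (fun s => arm s ω) (fun s => X s ω) t a - μ a)}
      ≤ ENNReal.ofReal (Real.exp (-(n * (z ^ 2 / 2)))) := by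
  refine h.measure_le_of_exp_le_weight
    (w := fun r => ENNReal.ofReal (Real.exp (s * z * (r - μ a) - (s * z) ^ 2 / 2)))
    (by fun_prop) (RewardFamily.lintegral_exp_law_le ha (s * z)) _ ?_
  rintro ω ⟨t, hn, hd⟩
  refine ⟨t, ?_⟩
  rw [weight_exp]
  refine ENNReal.ofReal_le_ofReal (Real.exp_le_exp.2 ?_)
  have hn' : (n : ℝ) ≤ pulls (fun s => arm s ω) t a := by exact_mod_cast hn
  refine (mul_le_mul_of_nonneg_right hn' (by positivity)).trans ?_
  refine mul_le_mul_of_nonneg_left ?_ (by positivity)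
  rw [mul_pow, hs]
  nlinarith [mul_le_mul_of_nonneg_left hd hz]

lemma sum_measure_unreliable_le [Fintype A] (h : IsBanditRun P ℱ (fun a => F.law (μ a)) arm X)
    (hμ : ∀ a, μ a ∈ F.closedMeans) {ε : ℝ} (hε : 0 < ε) (T : ℕ) :
    ∑ n ∈ Finset.Icc 1 T, P {ω | Unreliable μ ε (fun s => arm s ω) (fun s => X s ω) n}
      ≤ ENNReal.ofReal (Fintype.card A * (4 / ε ^ 2)) := by
  have h1 : ∀ n : ℕ, P {ω | Unreliable μ ε (fun s => arm s ω) (fun s => X s ω) n}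
      ≤ ENNReal.ofReal (Fintype.card A * (2 * Real.exp (-(n * (ε ^ 2 / 2))))) := by
    intro n
    have hsub : {ω | Unreliable μ ε (fun s => arm s ω) (fun s => X s ω) n} ⊆
        ⋃ a, ({ω | ∃ t, n ≤ pulls (fun s => arm s ω) t a ∧
            ε ≤ 1 * (empMean (fun s => arm s ω) (fun s => X s ω) t a - μ a)} ∪
          {ω | ∃ t, n ≤ pulls (fun s => arm s ω) t a ∧
            ε ≤ (-1) * (empMean (fun s => arm s ω) (fun s => X s ω) t a - μ a)}) := by
      rintro ω ⟨t, a, hn, hd⟩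
      refine Set.mem_iUnion.2 ⟨a, ?_⟩
      rcases le_abs.1 hd with hd | hd
      · exact Or.inl ⟨t, hn, by linarith⟩
      · exact Or.inr ⟨t, hn, by linarith⟩
    refine (measure_mono hsub).trans ((measure_iUnion_fintype_le _ _).trans ?_)
    calc _ ≤ ∑ _a : A, ENNReal.ofReal (2 * Real.exp (-(n * (ε ^ 2 / 2)))) := by
          refine Finset.sum_le_sum fun a _ => (measure_union_le _ _).trans ?_
          rw [two_mul, ENNReal.ofReal_add (Real.exp_pos _).le (Real.exp_pos _).le]
          exact add_le_add
            (h.measure_exists_mul_deviation_ge_le (hμ a) n (by norm_num) hε.le)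
            (h.measure_exists_mul_deviation_ge_le (hμ a) n (by norm_num) hε.le)
      _ = _ := by
          rw [Finset.sum_const, nsmul_eq_mul, Finset.card_univ,
            ENNReal.ofReal_mul (p := (Fintype.card A : ℝ)) (by positivity),
            ENNReal.ofReal_natCast]
  refine (Finset.sum_le_sum fun n _ => h1 n).trans ?_
  rw [← ENNReal.ofReal_sum_of_nonneg (fun _ _ => by positivity), ← Finset.mul_sum,
    ← Finset.mul_sum]
  refine ENNReal.ofReal_le_ofReal (mul_le_mul_of_nonneg_left ?_ (by positivity))
  have := sum_exp_neg_mul_le (show 0 < ε ^ 2 / 2 by positivity) T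
  calc 2 * _ ≤ 2 * (1 / (ε ^ 2 / 2)) := by gcongr
    _ = _ := by field_simp; norm_num

end IsBanditRun

/-! ### Underrated arms: Gaussian rewards -/

lemma tsum_ofReal_mul_exp_le {u : ℝ} (hu : 0 < u) :
    ∑' m : ℕ, ENNReal.ofReal (m * Real.exp (-(m * u))) ≤ ENNReal.ofReal (1 / u ^ 2) := by
  have hq : ‖Real.exp (-u)‖ < 1 := by
    rw [Real.norm_of_nonneg (Real.exp_pos _).le]; simpa using hu
  have e : ∀ m : ℕ, m * Real.exp (-(m * u)) = m * Real.exp (-u) ^ m := fun m => by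
    rw [← Real.exp_nat_mul]; ring_nf
  simp only [e]
  have hs := (summable_pow_mul_geometric_of_norm_lt_one 1 hq)
  simp only [pow_one] at hs
  rw [← ENNReal.ofReal_tsum_of_nonneg (fun _ => by positivity) hs,
    tsum_coe_mul_geometric_of_norm_lt_one hq]
  refine ENNReal.ofReal_le_ofReal ?_
  -- The quotient is `1 / (2 sinh (u / 2)) ^ 2`.
  have h1 : u / 2 ≤ Real.sinh (u / 2) := Real.self_le_sinh_iff.2 (by positivity)
  have h2 : u ≤ Real.exp (u / 2) - Real.exp (-(u / 2)) := by
    rw [Real.sinh_eq] at h1; linarith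
  have h3 : Real.exp (-u) = Real.exp (-(u / 2)) ^ 2 := by
    rw [← Real.exp_nat_mul]; ring_nf
  have h4 : Real.exp (u / 2) * Real.exp (-(u / 2)) = 1 := by rw [← Real.exp_add]; simp
  have h5 : 0 < Real.exp (-(u / 2)) := Real.exp_pos _
  have h6 : Real.exp (-(u / 2)) * u ≤ 1 - Real.exp (-u) := by
    rw [h3]; nlinarith [mul_le_mul_of_nonneg_left h2 h5.le]
  have h7 : 0 < 1 - Real.exp (-u) := lt_of_lt_of_le (by positivity) h6
  rw [div_le_div_iff₀ (by positivity) (by positivity), h3, ← mul_pow, one_mul, ← h3]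
  exact pow_le_pow_left₀ (by positivity) h6 2

lemma tsum_ofReal_one_div_odd_sq_le {c : ℝ} (hc : 0 ≤ c) :
    ∑' j : ℕ, ENNReal.ofReal (c / (2 * j + 3) ^ 2) ≤ ENNReal.ofReal (c / 4) := by
  refine ENNReal.tsum_le_of_sum_range_le fun n => ?_
  rw [← ENNReal.ofReal_sum_of_nonneg (fun _ _ => by positivity)]
  refine ENNReal.ofReal_le_ofReal ?_
  suffices H : ∑ j ∈ Finset.range n, c / (2 * (j : ℝ) + 3) ^ 2 ≤ c / 4 - c / (4 * n + 4) by
    refine H.trans (sub_le_self _ (by positivity))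
  induction n with
  | zero => simp
  | succ n ih =>
    rw [Finset.sum_range_succ]
    have : c / (2 * (n : ℝ) + 3) ^ 2 ≤ c / (4 * n + 4) - c / (4 * (n + 1 : ℕ) + 4) := by
      push_cast
      rw [div_sub_div _ _ (by positivity) (by positivity),
        div_le_div_iff₀ (by positivity) (by positivity)]
      nlinarith [mul_nonneg hc (Nat.cast_nonneg (α := ℝ) n)]
    linarith

namespace IsBanditRun

variable {A Ω : Type*} [DecidableEq A] {mΩ : MeasurableSpace Ω} {P : Measure Ω}
  [IsProbabilityMeasure P] {ℱ : Filtration ℕ mΩ} {F : RewardFamily} {μ : A → ℝ}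
  {arm : ℕ → Ω → A} {X : ℕ → Ω → ℝ}

/-- For Gaussian rewards, the values of the empirical mean below `μ a - ε` are cut into bins of
width `ε / 2`. -/
lemma sum_measure_underrated_gaussian_le
    (h : IsBanditRun P ℱ (fun a => RewardFamily.gaussian.law (μ a)) arm X) (a : A) {ε : ℝ}
    (hε : 0 < ε) (T : ℕ) :
    ∑ n ∈ Finset.Icc 1 T, P {ω | ∃ t, empMean (fun s => arm s ω) (fun s => X s ω) t a < μ a - ε ∧
      ENNReal.log (n : ℝ≥0∞) ≤ indexWith (fun s => arm s ω) t a
        (RewardFamily.gaussian.kl (empMean (fun s => arm s ω) (fun s => X s ω) t a) (μ a - ε))}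
      ≤ ENNReal.ofReal (16 / ε ^ 4) := by
  -- The bin `(j, m)`: the arm has `m` pulls and its empirical mean is at least `(j + 2) ε / 2`
  -- below `μ a`.
  let E : ℕ × ℕ → Set Ω := fun i => {ω | ∃ t, i.2 = pulls (fun s => arm s ω) t a ∧
      (i.1 + 2) * (ε / 2) ≤ μ a - empMean (fun s => arm s ω) (fun s => X s ω) t a}
  let W : ℕ × ℕ → ℝ := fun i => i.2 * Real.exp (i.2 * (((i.1 + 1) * (ε / 2)) ^ 2 / 2))
  let p : ℕ × ℕ → ℝ := fun i => Real.exp (-(i.2 * (((i.1 + 2) * (ε / 2)) ^ 2 / 2)))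
  refine (sum_measure_le_tsum (E := E) (W := W) (p := p) (fun i => by positivity)
    (ae_of_all _ ?_) ?_ T).trans ?_
  · rintro ω n hn ⟨t, hlt, hlog⟩
    rw [RewardFamily.kl_eq_ofReal (Set.mem_univ _) (Set.mem_univ _)] at hlog
    obtain ⟨h1, h2⟩ := le_mul_exp_of_log_le_indexWith hn
      (RewardFamily.klReal_nonneg (Set.mem_univ _) (Set.mem_univ _)) hlog
    set x := empMean (fun s => arm s ω) (fun s => X s ω) t a
    set N := pulls (fun s => arm s ω) t a
    have hy : 0 < μ a - ε - x := by linarith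
    have hj1 : (⌊(μ a - ε - x) / (ε / 2)⌋₊ : ℝ) * (ε / 2) ≤ μ a - ε - x :=
      (le_div_iff₀ (by positivity)).1 (Nat.floor_le (by positivity))
    have hj2 : μ a - ε - x ≤ (⌊(μ a - ε - x) / (ε / 2)⌋₊ + 1) * (ε / 2) :=
      ((div_lt_iff₀ (by positivity)).1 (Nat.lt_floor_add_one _)).le
    refine ⟨(⌊(μ a - ε - x) / (ε / 2)⌋₊, N), ⟨t, rfl, ?_⟩, h2.trans ?_⟩
    · change ((_ : ℝ) + 2) * (ε / 2) ≤ μ a - x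
      linarith
    · simp only [W, RewardFamily.klReal]
      rw [← neg_sq (x - (μ a - ε)), neg_sub]
      gcongr
  · rintro ⟨j, m⟩ -
    refine (measure_mono ?_).trans (h.measure_exists_mul_deviation_ge_le (a := a) (Set.mem_univ _) m
      (s := -1) (z := (j + 2) * (ε / 2)) (by norm_num) (by positivity))
    rintro ω ⟨t, ht, hd⟩
    refine ⟨t, ht.le, ?_⟩
    dsimp only at hd
    linarith
  · rw [ENNReal.tsum_prod']
    calc ∑' (j : ℕ) (m : ℕ), ENNReal.ofReal (W (j, m) * p (j, m))
        = ∑' (j : ℕ) (m : ℕ),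
            ENNReal.ofReal (m * Real.exp (-(m * (ε ^ 2 * (2 * j + 3) / 8)))) := by
          refine tsum_congr fun j => tsum_congr fun m => ?_
          simp only [W, p]
          rw [mul_assoc, ← Real.exp_add]
          congr 3
          ring
      _ ≤ ∑' j : ℕ, ENNReal.ofReal (64 / ε ^ 4 / (2 * j + 3) ^ 2) := by
          refine ENNReal.tsum_le_tsum fun j => (tsum_ofReal_mul_exp_le (by positivity)).trans
            (le_of_eq ?_)
          congr 1
          field_simp
          norm_num
      _ ≤ ENNReal.ofReal (64 / ε ^ 4 / 4) := tsum_ofReal_one_div_odd_sq_le (by positivity)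
      _ = _ := by congr 1; ring

end IsBanditRun

/-! ### Underrated arms: Bernoulli rewards -/

/-- A form of Pinsker's inequality. -/
lemma two_mul_sq_le_klReal_bernoulli {x y : ℝ} (hx : x ∈ Set.Icc (0 : ℝ) 1)
    (hy : y ∈ Set.Ioo (0 : ℝ) 1) : 2 * (x - y) ^ 2 ≤ RewardFamily.bernoulli.klReal x y := by
  obtain ⟨hy0, hy1⟩ := hy
  set l := 4 * (x - y)
  set Z := y * Real.exp l + (1 - y)
  have hye : 0 < y * Real.exp l := mul_pos hy0 (Real.exp_pos _)
  have hZ : 0 < Z := by simp only [Z]; linarith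
  -- Hoeffding's lemma bounds the moment generating function of the law of mean `y`.
  have h1 : Real.log Z ≤ l * y + l ^ 2 / 8 := by
    have h := (RewardFamily.hasSubgaussianMGF_law (F := .bernoulli) (m := y)
      ⟨hy0.le, hy1.le⟩).mgf_le l
    rw [mgf, RewardFamily.integral_law_bernoulli ⟨hy0.le, hy1.le⟩] at h
    rw [Real.log_le_iff_le_exp hZ, Real.exp_add]
    have e : Z = Real.exp (l * y)
        * (y * Real.exp (l * (1 - y)) + (1 - y) * Real.exp (l * (0 - y))) := by
      have e1 : Real.exp (l * y) * Real.exp (l * (1 - y)) = Real.exp l := by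
        rw [← Real.exp_add]; ring_nf
      have e2 : Real.exp (l * y) * Real.exp (l * (0 - y)) = 1 := by
        rw [← Real.exp_add]; ring_nf; simp
      linear_combination -y * e1 - (1 - y) * e2
    rw [e]
    refine mul_le_mul_of_nonneg_left (h.trans (le_of_eq ?_)) (Real.exp_pos _).le
    congr 1
    norm_num
    ring
  -- Gibbs' inequality for the exponentially tilted law.
  have h2 := RewardFamily.klReal_nonneg (F := .bernoulli) (x := x) (y := y * Real.exp l / Z) hx
    ⟨by positivity, by rw [div_lt_one hZ]; simp only [Z]; linarith⟩
  have e3 : 1 - y * Real.exp l / Z = (1 - y) / Z := by field_simp; simp only [Z]; ring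
  have hy1' : 0 < 1 - y := by linarith
  simp only [RewardFamily.klReal] at h2 ⊢
  rw [e3, RewardFamily.mul_log_div x (by positivity),
    RewardFamily.mul_log_div (1 - x) (by positivity), Real.log_div hye.ne' hZ.ne',
    Real.log_div hy1'.ne' hZ.ne', Real.log_mul hy0.ne' (Real.exp_pos _).ne', Real.log_exp] at h2
  rw [RewardFamily.mul_log_div x hy0, RewardFamily.mul_log_div (1 - x) hy1']
  simp only [l] at h1 h2
  nlinarith

lemma pow_eq_exp_mul_log {r : ℝ} {k : ℕ} (hr : 0 ≤ r) (h : r = 0 → k = 0) :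
    r ^ k = Real.exp (k * Real.log r) := by
  rcases hr.eq_or_lt with h0 | h0
  · simp [h h0.symm]
  · rw [Real.exp_nat_mul, Real.exp_log h0]

lemma tsum_ofReal_succ_mul_mul_exp_le {u : ℝ} (hu : 0 < u) :
    ∑' m : ℕ, ENNReal.ofReal ((m + 1) * (m * Real.exp (-(m * u))))
      ≤ ENNReal.ofReal (2 * ((1 + u) / u) ^ 3) := by
  have hq : ‖Real.exp (-u)‖ < 1 := by
    rw [Real.norm_of_nonneg (Real.exp_pos _).le]; simpa using hu
  have e : ∀ m : ℕ, (m + 1) * (m * Real.exp (-(m * u)))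
      ≤ 2 * (((m + 2).choose 2 : ℕ) * Real.exp (-u) ^ m) := fun m => by
    rw [← Real.exp_nat_mul, Nat.cast_choose_two]
    push_cast
    have : 0 < Real.exp (-(m * u)) := Real.exp_pos _
    rw [mul_neg]
    nlinarith [mul_nonneg (Nat.cast_nonneg (α := ℝ) m) this.le]
  refine (ENNReal.tsum_le_tsum fun m => ENNReal.ofReal_le_ofReal (e m)).trans ?_
  have hs := summable_choose_mul_geometric_of_norm_lt_one 2 hq
  rw [← ENNReal.ofReal_tsum_of_nonneg (fun _ => by positivity) (hs.mul_left 2), tsum_mul_left,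
    tsum_choose_mul_geometric_of_norm_lt_one 2 hq]
  refine ENNReal.ofReal_le_ofReal (mul_le_mul_of_nonneg_left ?_ zero_le_two)
  have h1 : u + 1 ≤ Real.exp u := Real.add_one_le_exp u
  have h2 : Real.exp (-u) * Real.exp u = 1 := by rw [← Real.exp_add]; simp
  have h3 : 0 < Real.exp (-u) := Real.exp_pos _
  have h4 : 0 < 1 - Real.exp (-u) := by
    rw [Real.norm_of_nonneg h3.le] at hq; linarith
  rw [one_div, ← inv_pow]
  refine pow_le_pow_left₀ (by positivity) ?_ 3
  rw [inv_le_iff_one_le_mul₀ h4, div_mul_eq_mul_div, le_div_iff₀ hu]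
  nlinarith [mul_le_mul_of_nonneg_left h1 h3.le]

namespace IsBanditRun

variable {A Ω : Type*} {mΩ : MeasurableSpace Ω} {P : Measure Ω}
  [IsProbabilityMeasure P] {ℱ : Filtration ℕ mΩ} {μ : A → ℝ}
  {arm : ℕ → Ω → A} {X : ℕ → Ω → ℝ}

lemma ae_forall_reward_zero_or_one
    (h : IsBanditRun P ℱ (fun a => RewardFamily.bernoulli.law (μ a)) arm X)
    (hμ : ∀ a, μ a ∈ Set.Icc (0 : ℝ) 1) : ∀ᵐ ω ∂P, ∀ t, X (t + 1) ω ∈ ({0, 1} : Set ℝ) := by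
  refine h.ae_forall_reward_mem (by measurability) fun a => ?_
  rw [RewardFamily.law_bernoulli_eq (hμ a)]
  simp [← ENNReal.ofReal_add (hμ a).1 (sub_nonneg.2 (hμ a).2)]

variable [DecidableEq A]

/-- Chernoff bound for the event that `m` rewards of a Bernoulli arm contain exactly `k` ones. -/
lemma measure_exists_sum_eq_le
    (h : IsBanditRun P ℱ (fun a => RewardFamily.bernoulli.law (μ a)) arm X) {a : A}
    (ha : μ a ∈ Set.Ioo (0 : ℝ) 1) {m k : ℕ} (hm : 1 ≤ m) (hk : k ≤ m) :
    P {ω | (∀ t, X (t + 1) ω ∈ ({0, 1} : Set ℝ)) ∧ ∃ t, pulls (fun s => arm s ω) t a = m ∧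
      ∑ s ∈ pullTimes (fun s => arm s ω) t a, X s ω = k}
      ≤ ENNReal.ofReal (Real.exp (-(m * RewardFamily.bernoulli.klReal (k / m) (μ a)))) := by
  obtain ⟨h0, h1⟩ := ha
  have h1' : 0 < 1 - μ a := by linarith
  have hm0 : (0 : ℝ) < m := by exact_mod_cast hm
  have hkm : (k : ℝ) / m ≤ 1 := by
    rw [div_le_one hm0]; exact_mod_cast hk
  have hr1 : 0 ≤ k / m / μ a := by positivity
  have hr0 : 0 ≤ (1 - k / m) / (1 - μ a) := div_nonneg (by linarith) h1'.le
  -- The weight is the likelihood ratio of the laws of means `k / m` and `μ a`.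
  refine h.measure_le_of_exp_le_weight (a := a)
    (w := fun r => ENNReal.ofReal (if r = 1 then k / m / μ a else (1 - k / m) / (1 - μ a)))
    (Measurable.ennreal_ofReal (Measurable.ite (measurableSet_singleton 1) measurable_const
      measurable_const)) ?_ _ ?_
  · rw [RewardFamily.lintegral_law_bernoulli ⟨h0.le, h1.le⟩]
    simp only [if_true, zero_ne_one, if_false]
    rw [← ENNReal.ofReal_mul h0.le, ← ENNReal.ofReal_mul h1'.le, mul_div_cancel₀ _ h0.ne',
      mul_div_cancel₀ _ h1'.ne', ← ENNReal.ofReal_add (by positivity) (by linarith)]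
    simp
  · rintro ω ⟨hX, t, hpulls, hsum⟩
    refine ⟨t, le_of_eq ?_⟩
    set S := pullTimes (fun s => arm s ω) t a
    have hX' : ∀ s ∈ S, X s ω = if X s ω = 1 then 1 else 0 := by
      intro s hs
      have hs1 : 1 ≤ s := (Finset.mem_Icc.1 (Finset.mem_filter.1 hs).1).1
      obtain ⟨s, rfl⟩ := Nat.exists_eq_add_of_le' hs1
      rcases hX s with h | h
      · simp [h]
      · rw [Set.mem_singleton_iff.1 h]; simp
    have hc1 : (S.filter fun s => X s ω = 1).card = k := by
      rw [Finset.sum_congr rfl hX', Finset.sum_ite, Finset.sum_const, Finset.sum_const_zero] at hsum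
      simpa using hsum
    have hc0 : (S.filter fun s => ¬X s ω = 1).card = m - k := by
      have := Finset.card_filter_add_card_filter_not (s := S) (fun s => X s ω = 1)
      have hS : S.card = m := hpulls
      omega
    rw [weight, ← ENNReal.ofReal_prod_of_nonneg (fun _ _ => by split_ifs <;> assumption),
      Finset.prod_ite, Finset.prod_const, Finset.prod_const, hc1, hc0,
      pow_eq_exp_mul_log hr1 ?_, pow_eq_exp_mul_log hr0 ?_, ← Real.exp_add]
    · congr 2
      rw [RewardFamily.klReal, Nat.cast_sub hk]
      field_simp
    · intro h
      have h' : (k : ℝ) / m = 1 := by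
        rcases div_eq_zero_iff.1 h with h | h <;> linarith
      rw [div_eq_one_iff_eq hm0.ne'] at h'
      have : k = m := by exact_mod_cast h'
      omega
    · intro h
      have h' : (k : ℝ) = 0 := by
        rcases div_eq_zero_iff.1 h with h | h
        · rcases div_eq_zero_iff.1 h with h | h
          · exact h
          · exact absurd h hm0.ne'
        · exact absurd h h0.ne'
      exact_mod_cast h'

/-- For Bernoulli rewards, `m` rewards have one of the `m + 1` sums `0, …, m`. -/
lemma sum_measure_underrated_bernoulli_le
    (h : IsBanditRun P ℱ (fun a => RewardFamily.bernoulli.law (μ a)) arm X)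
    (hμ : ∀ a, μ a ∈ Set.Ioo (0 : ℝ) 1) (a : A) {ε : ℝ} (hε : 0 < ε) (hεa : ε < μ a)
    (hε2 : ε ≤ 1 / 2) (T : ℕ) :
    ∑ n ∈ Finset.Icc 1 T, P {ω | ∃ t, empMean (fun s => arm s ω) (fun s => X s ω) t a < μ a - ε ∧
      ENNReal.log (n : ℝ≥0∞) ≤ indexWith (fun s => arm s ω) t a
        (RewardFamily.bernoulli.kl (empMean (fun s => arm s ω) (fun s => X s ω) t a) (μ a - ε))}
      ≤ ENNReal.ofReal (1 / ε ^ 6) := by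
  set μ' := μ a - ε
  have hμ' : μ' ∈ Set.Ioo (0 : ℝ) 1 := ⟨by simp only [μ']; linarith, by
    simp only [μ']; linarith [(hμ a).2]⟩
  let E : ℕ × ℕ → Set Ω := fun i => {ω | (∀ t, X (t + 1) ω ∈ ({0, 1} : Set ℝ)) ∧
    ∃ t, pulls (fun s => arm s ω) t a = i.1 ∧
      ∑ s ∈ pullTimes (fun s => arm s ω) t a, X s ω = i.2}
  let W : ℕ × ℕ → ℝ := fun i => if 1 ≤ i.1 ∧ (i.2 : ℝ) ≤ i.1 * μ' then
    i.1 * Real.exp (i.1 * RewardFamily.bernoulli.klReal (i.2 / i.1) μ') else 0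
  let p : ℕ × ℕ → ℝ := fun i =>
    Real.exp (-(i.1 * RewardFamily.bernoulli.klReal (i.2 / i.1) (μ a)))
  have hle : ∀ m k : ℕ, (k : ℝ) ≤ m * μ' → k ≤ m := fun m k hk => by
    have : (k : ℝ) ≤ m := hk.trans (mul_le_of_le_one_right (Nat.cast_nonneg _) hμ'.2.le)
    exact_mod_cast this
  refine (sum_measure_le_tsum (E := E) (W := W) (p := p)
    (fun i => by simp only [W]; split_ifs <;> positivity) ?_ ?_ T).trans ?_
  · filter_upwards [h.ae_forall_reward_zero_or_one fun a => Set.Ioo_subset_Icc_self (hμ a)]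
      with ω hX n hn
    rintro ⟨t, hlt, hlog⟩
    set S := pullTimes (fun s => arm s ω) t a
    set N := pulls (fun s => arm s ω) t a
    have hmul := pulls_mul_empMean (fun s => arm s ω) (fun s => X s ω) t a
    set x := empMean (fun s => arm s ω) (fun s => X s ω) t a
    obtain ⟨k, hk⟩ : ∃ k : ℕ, ∑ s ∈ S, X s ω = k := by
      refine ⟨(S.filter fun s => X s ω = 1).card, ?_⟩
      rw [Finset.card_filter]
      push_cast
      refine Finset.sum_congr rfl fun s hs => ?_
      have hs1 : 1 ≤ s := (Finset.mem_Icc.1 (Finset.mem_filter.1 hs).1).1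
      obtain ⟨s, rfl⟩ := Nat.exists_eq_add_of_le' hs1
      rcases hX s with h | h
      · simp [h]
      · rw [Set.mem_singleton_iff.1 h]; simp
    have hN : 1 ≤ N := by
      by_contra h0
      rw [indexWith_eq_bot (by omega), le_bot_iff, ENNReal.log_eq_bot_iff] at hlog
      simp at hlog; omega
    have hN0 : (0 : ℝ) < N := by exact_mod_cast hN
    have hx : x = k / N := by
      rw [eq_div_iff hN0.ne', mul_comm]
      exact hmul.trans hk
    have hk1 : (k : ℝ) ≤ N * μ' := by
      rw [hx, div_lt_iff₀ hN0] at hlt; linarith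
    have hx01 : x ∈ Set.Icc (0 : ℝ) 1 := by
      rw [hx]
      refine ⟨by positivity, ?_⟩
      rw [div_le_one hN0]; exact_mod_cast hle N k hk1
    rw [RewardFamily.kl_eq_ofReal hx01 hμ'] at hlog
    obtain ⟨-, h2⟩ := le_mul_exp_of_log_le_indexWith hn
      (RewardFamily.klReal_nonneg hx01 hμ') hlog
    refine ⟨(N, k), ⟨hX, t, rfl, hk⟩, ?_⟩
    simp only [W]
    rw [if_pos ⟨hN, hk1⟩, ← hx]
    exact h2
  · rintro ⟨m, k⟩ hW
    by_cases hc : 1 ≤ m ∧ (k : ℝ) ≤ m * μ'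
    · exact h.measure_exists_sum_eq_le (hμ a) hc.1 (hle m k hc.2)
    · simp only [W, if_neg hc] at hW
      exact absurd hW (lt_irrefl _)
  · have hu : 0 < 2 * ε ^ 2 := by positivity
    -- Superadditivity of the divergence turns the product of a count and a probability into
    -- `m * exp (-m * KL(μ a - ε | μ a))`.
    have hprod : ∀ m k : ℕ, ENNReal.ofReal (W (m, k) * p (m, k))
        ≤ if k ∈ Finset.range (m + 1) then
            ENNReal.ofReal (m * Real.exp (-(m * (2 * ε ^ 2)))) else 0 := by
      intro m k
      by_cases hc : 1 ≤ m ∧ (k : ℝ) ≤ m * μ'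
      · have hm0 : (0 : ℝ) < m := by exact_mod_cast hc.1
        rw [if_pos (Finset.mem_range.2 (Nat.lt_succ_of_le (hle m k hc.2)))]
        simp only [W, p]
        rw [if_pos hc, mul_assoc, ← Real.exp_add]
        refine ENNReal.ofReal_le_ofReal ?_
        have hkx : (k : ℝ) / m ≤ μ' := by rw [div_le_iff₀ hm0, mul_comm]; exact hc.2
        have h1 := RewardFamily.klReal_add_le (F := .bernoulli) (x := k / m) (y := μ') (z := μ a)
          ⟨by positivity, hkx.trans hμ'.2.le⟩ hμ' (hμ a) hkx (by simp only [μ']; linarith)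
        have h2 := two_mul_sq_le_klReal_bernoulli (Set.Ioo_subset_Icc_self hμ') (hμ a)
        have h3 : μ' - μ a = -ε := by simp only [μ']; ring
        rw [h3, neg_sq] at h2
        gcongr
        nlinarith
      · simp [W, if_neg hc]
    rw [ENNReal.tsum_prod']
    calc ∑' (m : ℕ) (k : ℕ), ENNReal.ofReal (W (m, k) * p (m, k))
        ≤ ∑' m : ℕ, ENNReal.ofReal ((m + 1) * (m * Real.exp (-(m * (2 * ε ^ 2))))) := by
          refine ENNReal.tsum_le_tsum fun m => (ENNReal.tsum_le_tsum (hprod m)).trans ?_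
          rw [tsum_eq_sum (s := Finset.range (m + 1)) (fun k hk => if_neg hk),
            Finset.sum_ite_mem, Finset.inter_self, Finset.sum_const, Finset.card_range,
            nsmul_eq_mul, ENNReal.ofReal_mul (p := (m : ℝ) + 1) (by positivity)]
          refine mul_le_mul' (le_of_eq ?_) le_rfl
          rw [← ENNReal.ofReal_natCast]
          push_cast
          rfl
      _ ≤ ENNReal.ofReal (2 * ((1 + 2 * ε ^ 2) / (2 * ε ^ 2)) ^ 3) :=
          tsum_ofReal_succ_mul_mul_exp_le hu
      _ ≤ ENNReal.ofReal (1 / ε ^ 6) := by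
          refine ENNReal.ofReal_le_ofReal ?_
          have h1 : (1 + 2 * ε ^ 2) / (2 * ε ^ 2) ≤ 3 / 4 / ε ^ 2 := by
            rw [div_le_div_iff₀ hu (by positivity)]
            nlinarith [mul_pos hε hε, mul_nonneg (mul_pos hε hε).le
              (show 0 ≤ 1 / 4 - ε ^ 2 by nlinarith)]
          calc 2 * ((1 + 2 * ε ^ 2) / (2 * ε ^ 2)) ^ 3 ≤ 2 * (3 / 4 / ε ^ 2) ^ 3 := by gcongr
            _ = 27 / 32 / ε ^ 6 := by field_simp; norm_num
            _ ≤ 1 / ε ^ 6 := by gcongr; norm_num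

end IsBanditRun

/-! ### The two kinds of exceptional events together -/

lemma IsBanditRun.sum_measure_exceptional_le {A Ω : Type*} [Fintype A] [DecidableEq A]
    {mΩ : MeasurableSpace Ω} {P : Measure Ω} [IsProbabilityMeasure P] {ℱ : Filtration ℕ mΩ}
    {F : RewardFamily} {μ : A → ℝ} {arm : ℕ → Ω → A} {X : ℕ → Ω → ℝ}
    (h : IsBanditRun P ℱ (fun a => F.law (μ a)) arm X) (hμ : ∀ a, μ a ∈ F.means) {ε : ℝ}
    (hε : 0 < ε) (hε2 : ε ≤ 1 / 2) (T : ℕ) :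
    ∑ n ∈ Finset.Icc 1 T, P {ω | Unreliable μ ε (fun s => arm s ω) (fun s => X s ω) n ∨
        Underrated F μ ε (fun s => arm s ω) (fun s => X s ω) n}
      ≤ ENNReal.ofReal (Fintype.card A * (5 * ε⁻¹ ^ 6)) := by
  have hsq : ε ^ 2 ≤ 1 / 4 := by nlinarith
  have hunder : ∀ a, ∑ n ∈ Finset.Icc 1 T,
      P {ω | μ a - ε ∈ F.means ∧
          ∃ t, empMean (fun s => arm s ω) (fun s => X s ω) t a < μ a - ε ∧
        ENNReal.log (n : ℝ≥0∞) ≤ indexWith (fun s => arm s ω) t a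
          (F.kl (empMean (fun s => arm s ω) (fun s => X s ω) t a) (μ a - ε))}
        ≤ ENNReal.ofReal (4 * ε⁻¹ ^ 6) := by
    intro a
    by_cases hεμ : μ a - ε ∈ F.means
    swap
    · simp [hεμ]
    simp only [hεμ, true_and]
    cases F
    · refine (h.sum_measure_underrated_gaussian_le a hε T).trans (ENNReal.ofReal_le_ofReal ?_)
      rw [inv_pow, ← div_eq_mul_inv, div_le_div_iff₀ (by positivity) (by positivity)]
      nlinarith [pow_pos hε 4]
    · refine (h.sum_measure_underrated_bernoulli_le hμ a hε (by linarith [hεμ.1]) hε2 T).trans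
        (ENNReal.ofReal_le_ofReal ?_)
      rw [inv_pow, ← div_eq_mul_inv]
      gcongr
      norm_num
  have hu := h.sum_measure_unreliable_le (fun a => F.means_subset_closedMeans (hμ a)) hε T
  calc _ ≤ ∑ n ∈ Finset.Icc 1 T,
        (P {ω | Unreliable μ ε (fun s => arm s ω) (fun s => X s ω) n} +
        ∑ a, P {ω | μ a - ε ∈ F.means ∧
          ∃ t, empMean (fun s => arm s ω) (fun s => X s ω) t a < μ a - ε ∧
          ENNReal.log (n : ℝ≥0∞) ≤ indexWith (fun s => arm s ω) t a
            (F.kl (empMean (fun s => arm s ω) (fun s => X s ω) t a) (μ a - ε))}) := by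
        refine Finset.sum_le_sum fun n _ => (measure_union_le _ _).trans (add_le_add le_rfl ?_)
        refine (measure_mono ?_).trans (measure_iUnion_fintype_le _ _)
        rintro ω ⟨a, ha⟩
        exact Set.mem_iUnion.2 ⟨a, ha⟩
    _ ≤ ENNReal.ofReal (Fintype.card A * (4 / ε ^ 2))
        + ∑ _a : A, ENNReal.ofReal (4 * ε⁻¹ ^ 6) := by
        rw [Finset.sum_add_distrib, Finset.sum_comm]
        exact add_le_add hu (Finset.sum_le_sum fun a _ => hunder a)
    _ = ENNReal.ofReal (Fintype.card A * (4 / ε ^ 2) + Fintype.card A * (4 * ε⁻¹ ^ 6)) := by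
        rw [ENNReal.ofReal_add (by positivity) (by positivity), Finset.sum_const, nsmul_eq_mul,
          Finset.card_univ, ENNReal.ofReal_mul (p := (Fintype.card A : ℝ)) (by positivity)
            (q := 4 * ε⁻¹ ^ 6), ENNReal.ofReal_natCast]
    _ ≤ _ := by
        refine ENNReal.ofReal_le_ofReal ?_
        rw [← mul_add]
        refine mul_le_mul_of_nonneg_left ?_ (Nat.cast_nonneg _)
        have h4 : ε ^ 4 ≤ 1 / 16 := by nlinarith [sq_nonneg (ε ^ 2)]
        have : 4 / ε ^ 2 ≤ ε⁻¹ ^ 6 := by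
          rw [inv_pow, ← one_div, div_le_div_iff₀ (by positivity) (by positivity)]
          nlinarith [pow_pos hε 2]
        linarith

/-! ### Increasing paths and cuts of trees -/

lemma IsUnimodal.exists_adj_lt {A : Type*} {G : SimpleGraph A} {μ : A → ℝ} {astar : A}
    (h : IsUnimodal G μ astar) {b : A} (hb : b ≠ astar) : ∃ a, G.Adj b a ∧ μ b < μ a := by
  obtain ⟨p, hp⟩ := h.path b hb
  cases p with
  | nil => exact absurd rfl hb
  | @cons _ v _ hadj q =>
    refine ⟨v, hadj, ?_⟩
    rw [SimpleGraph.Walk.support_cons, ← q.cons_tail_support, List.isChain_cons_cons] at hp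
    exact hp.1

lemma notMem_cutSide {A : Type*} {G : SimpleGraph A} (hG : G.IsTree) {b c : A}
    (hbc : G.Adj b c) : b ∉ cutSide G b c :=
  (SimpleGraph.isAcyclic_iff_forall_adj_isBridge.1 hG.isAcyclic hbc.symm)

lemma mem_cutSide_of_adj {A : Type*} {G : SimpleGraph A} {b c a v : A} (ha : a ∈ cutSide G b c)
    (hav : G.Adj a v) (hne : s(a, v) ≠ s(c, b)) : v ∈ cutSide G b c := by
  refine SimpleGraph.Reachable.trans ha (SimpleGraph.Adj.reachable ?_)
  rw [SimpleGraph.deleteEdges_adj]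
  exact ⟨hav, hne⟩

/-- On the side of `c`, the edge to `b` being cut, `c` is the only neighbour of `b`. -/
lemma eq_of_mem_cutSide_of_adj {A : Type*} {G : SimpleGraph A} (hG : G.IsTree) {a b c : A}
    (hbc : G.Adj b c) (ha : a ∈ cutSide G b c) (hba : G.Adj b a) : a = c := by
  by_contra hac
  refine notMem_cutSide hG hbc (mem_cutSide_of_adj ha hba.symm fun h => hac ?_)
  rcases Sym2.eq_iff.1 h with ⟨h, -⟩ | ⟨-, h⟩
  · exact h
  · exact absurd h hbc.ne

/-- An increasing path to `b` that starts on the side of `c` passes through `c`. -/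
lemma le_of_mem_cutSide {A : Type*} {G : SimpleGraph A} (hG : G.IsTree) {μ : A → ℝ} {a b c : A}
    (hbc : G.Adj b c) (p : G.Walk a b) (hp : p.support.IsChain (fun v w => μ v < μ w))
    (ha : a ∈ cutSide G b c) : μ a ≤ μ c := by
  induction p with
  | nil => exact absurd ha (notMem_cutSide hG hbc)
  | @cons u v w hadj q ih =>
    rw [SimpleGraph.Walk.support_cons, ← q.cons_tail_support, List.isChain_cons_cons,
      q.cons_tail_support] at hp
    by_cases he : s(u, v) = s(c, w)
    · rcases Sym2.eq_iff.1 he with ⟨h1, -⟩ | ⟨h1, -⟩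
      · rw [h1]
      · exact absurd (h1 ▸ ha) (notMem_cutSide hG hbc)
    · exact hp.1.le.trans (ih hbc hp.2 (mem_cutSide_of_adj ha hadj he))

/-! ### Sample paths without exceptional events -/

section Paths

variable {A : Type*} {F : RewardFamily} {G : SimpleGraph A} {μ : A → ℝ}
  {arm : ℕ → A} {x : ℕ → ℝ} {astar : A} {ε : ℝ} {n t : ℕ}

lemma klPos_self (F : RewardFamily) (m : ℝ) : F.klPos m m = 0 := if_neg (lt_irrefl m)

lemma add_sub_mem_means (hμ : ∀ a, μ a ∈ F.means) (hε : 0 < ε)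
    (hgap : ∀ a b, μ a < μ b → μ a + 4 * ε < μ b) {a b : A} (hab : μ a < μ b) :
    μ a + ε ∈ F.means ∧ μ b - ε ∈ F.means := by
  have := hgap a b hab
  exact ⟨F.ordConnected_means.out (hμ a) (hμ b) ⟨by linarith, by linarith⟩,
    F.ordConnected_means.out (hμ a) (hμ b) ⟨by linarith, by linarith⟩⟩

lemma kl_shifted_ne_top (hμ : ∀ a, μ a ∈ F.means) (hε : 0 < ε)
    (hgap : ∀ a b, μ a < μ b → μ a + 4 * ε < μ b) {a b : A} (hab : μ a < μ b) :
    F.kl (μ a + ε) (μ b - ε) ≠ ⊤ :=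
  RewardFamily.kl_ne_top (F.means_subset_closedMeans (add_sub_mem_means hμ hε hgap hab).1)
    (add_sub_mem_means hμ hε hgap hab).2

variable [DecidableEq A]

lemma IsLeader.bestMean_eq [Finite A] {b : A} (h : IsLeader arm x t b) :
    bestMean arm x t = empMean arm x t b := by
  have : Nonempty A := ⟨b⟩
  exact le_antisymm (ciSup_le h.1) (le_ciSup (Set.finite_range (empMean arm x t)).bddAbove b)

lemma log_natCast_le_log_natCast {m n : ℕ} :
    ENNReal.log (m : ℝ≥0∞) ≤ ENNReal.log (n : ℝ≥0∞) ↔ m ≤ n := by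
  rw [ENNReal.log_le_log_iff, Nat.cast_le]

lemma imedIndex_leader [Finite A] {b : A} (h : IsLeader arm x t b) :
    imedIndex F arm x t b = ENNReal.log (pulls arm t b) := by
  rw [imedIndex, h.bestMean_eq, RewardFamily.kl_self, indexWith_zero]

/-- The upper bound on the number of pulls of an arm that follows from an upper bound on its
index. -/
lemma pulls_mul_toReal_le {a : A} {k k' : ℝ≥0∞} {m : ℕ} (ha : 1 ≤ pulls arm t a)
    (h : indexWith arm t a k ≤ ENNReal.log (m : ℝ≥0∞)) (hk : k' ≤ k) (hk' : k' ≠ ⊤) :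
    1 ≤ m ∧ pulls arm t a * k'.toReal ≤ Real.log m := by
  have hm : 1 ≤ m := ha.trans (log_natCast_le_log_natCast.1 ((log_pulls_le_indexWith ..).trans h))
  refine ⟨hm, ?_⟩
  have h1 := (indexWith_mono arm t a hk).trans h
  rw [← ENNReal.ofReal_toReal hk', indexWith_ofReal ha ENNReal.toReal_nonneg, log_natCast hm,
    EReal.coe_le_coe_iff] at h1
  have : 0 ≤ Real.log (pulls arm t a) := Real.log_natCast_nonneg _
  linarith

/-- On a sample path without underrated arms, the current best arm is optimal as soon as it is
reliable and its neighbours have indices of at least `log n`. -/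
lemma leader_eq_of_log_le_imedIndex [Finite A] (hU : IsUnimodal G μ astar)
    (hμ : ∀ a, μ a ∈ F.means) (hε : 0 < ε) (hgap : ∀ a b, μ a < μ b → μ a + 4 * ε < μ b)
    (hx : ∀ t a, empMean arm x t a ∈ F.closedMeans)
    (hrel : ¬Unreliable μ ε arm x n) (hund : ¬Underrated F μ ε arm x n) {b : A}
    (hb : IsLeader arm x t b) (hnb : n ≤ pulls arm t b)
    (hidx : ∀ a, G.Adj b a → ENNReal.log (n : ℝ≥0∞) ≤ imedIndex F arm x t a) : b = astar := by
  by_contra hne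
  obtain ⟨a, hadj, hlt⟩ := hU.exists_adj_lt hne
  have hb' : |empMean arm x t b - μ b| < ε := by
    by_contra h; exact hrel ⟨t, b, hnb, not_lt.1 h⟩
  have h1 := (abs_lt.1 hb').2
  have h2 := hgap b a hlt
  have h3 := hb.1 a
  have h4 := (add_sub_mem_means hμ hε hgap hlt).2
  refine hund ⟨a, h4, t, by linarith, (hidx a hadj).trans ?_⟩
  rw [imedIndex, hb.bestMean_eq]
  exact indexWith_mono arm t a (RewardFamily.kl_le_kl_right (hx t a)
    (F.means_subset_closedMeans h4) h3 (by linarith))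

/-- Divergences between reliable empirical means dominate those between the shifted true means. -/
lemma kl_shifted_le (hμ : ∀ a, μ a ∈ F.means) (hε : 0 < ε)
    (hgap : ∀ a b, μ a < μ b → μ a + 4 * ε < μ b)
    (hx : ∀ t a, empMean arm x t a ∈ F.closedMeans) (hrel : ¬Unreliable μ ε arm x n) {a b : A}
    (hab : μ a < μ b) (hna : n ≤ pulls arm t a) {u : ℝ} (hu : u ∈ F.closedMeans)
    (hbu : μ b - ε ≤ u) :
    F.kl (μ a + ε) (μ b - ε) ≤ F.kl (empMean arm x t a) u := by
  have ha' : |empMean arm x t a - μ a| < ε := by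
    by_contra h; exact hrel ⟨t, a, hna, not_lt.1 h⟩
  have h1 := (abs_lt.1 ha').2
  have h2 := hgap a b hab
  exact RewardFamily.kl_le_kl (hx t a) hu (by linarith) (by linarith) hbu
    (F.means_subset_closedMeans (add_sub_mem_means hμ hε hgap hab).1)

lemma sub_le_empMean_of_reliable (hrel : ¬Unreliable μ ε arm x n) {a : A}
    (hna : n ≤ pulls arm t a) : μ a - ε ≤ empMean arm x t a := by
  have ha' : |empMean arm x t a - μ a| < ε := by
    by_contra h; exact hrel ⟨t, a, hna, not_lt.1 h⟩
  linarith [(abs_lt.1 ha').1]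

lemma log_pulls_le_log (h : 1 ≤ pulls arm t astar) :
    Real.log (pulls arm t astar) ≤ Real.log t :=
  Real.log_le_log (by exact_mod_cast h) (by exact_mod_cast pulls_le arm t astar)

/-- Outside the exceptional events, IMED-UB pulls a suboptimal arm only if it is a neighbour of the
optimal arm with few pulls. -/
lemma FollowsIMEDUB.adj_and_pulls_mul_le [Finite A] (hF : FollowsIMEDUB F G arm x)
    (hU : IsUnimodal G μ astar) (hμ : ∀ a, μ a ∈ F.means) (hε : 0 < ε)
    (hgap : ∀ a b, μ a < μ b → μ a + 4 * ε < μ b)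
    (hx : ∀ t a, empMean arm x t a ∈ F.closedMeans) (ht : 1 ≤ t) {a : A} (ha : arm (t + 1) = a)
    (hne : a ≠ astar) (hn : 1 ≤ pulls arm t a)
    (hrel : ¬Unreliable μ ε arm x (pulls arm t a))
    (hund : ¬Underrated F μ ε arm x (pulls arm t a)) :
    G.Adj astar a ∧
      pulls arm t a * (F.kl (μ a + ε) (μ astar - ε)).toReal ≤ Real.log t := by
  obtain ⟨b, hb, hmem, hmin⟩ := hF t ht
  rw [ha] at hmem hmin
  have h1 : imedIndex F arm x t a ≤ ENNReal.log (pulls arm t b) := by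
    rw [← imedIndex_leader hb]; exact hmin (Or.inl rfl)
  have h2 : pulls arm t a ≤ pulls arm t b :=
    log_natCast_le_log_natCast.1 ((log_pulls_le_indexWith ..).trans h1)
  obtain rfl : b = astar := leader_eq_of_log_le_imedIndex hU hμ hε hgap hx hrel hund hb h2
    fun c hc => (log_pulls_le_indexWith ..).trans (hmin (Or.inr hc))
  have hadj : G.Adj b a := hmem.resolve_left hne
  have hlt := hU.optimal a hne
  obtain ⟨h3, h4⟩ := pulls_mul_toReal_le hn h1
    (kl_shifted_le hμ hε hgap hx hrel hlt le_rfl (hb.bestMean_eq ▸ hx t b)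
      (hb.bestMean_eq ▸ sub_le_empMean_of_reliable hrel h2))
    (kl_shifted_ne_top hμ hε hgap hlt)
  exact ⟨hadj, h4.trans (log_pulls_le_log h3)⟩

/-- Outside the exceptional events, d-IMED-UB pulls a suboptimal arm only if it is a neighbour of
the optimal arm with few pulls, or if it has few pulls relative to such a neighbour. -/
lemma FollowsDIMEDUB.pulls_mul_le [Finite A] (hF : FollowsDIMEDUB F G arm x) (hG : G.IsTree)
    (hU : IsUnimodal G μ astar) (hμ : ∀ a, μ a ∈ F.means) (hinj : Function.Injective μ)
    (hε : 0 < ε) (hgap : ∀ a b, μ a < μ b → μ a + 4 * ε < μ b)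
    (hx : ∀ t a, empMean arm x t a ∈ F.closedMeans) (ht : 1 ≤ t) {a : A} (ha : arm (t + 1) = a)
    (hne : a ≠ astar) (hn : 1 ≤ pulls arm t a)
    (hrel : ¬Unreliable μ ε arm x (pulls arm t a))
    (hund : ¬Underrated F μ ε arm x (pulls arm t a)) :
    (G.Adj astar a ∧
      pulls arm t a * (F.kl (μ a + ε) (μ astar - ε)).toReal ≤ Real.log t) ∨
    (¬G.Adj astar a ∧ ∃ (c : A) (m : ℕ), G.Adj astar c ∧ μ a < μ c ∧ 1 ≤ m ∧
      m * (F.kl (μ c + ε) (μ astar - ε)).toReal ≤ Real.log t ∧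
      pulls arm t a * (F.kl (μ a + ε) (μ c - ε)).toReal ≤ Real.log m) := by
  obtain ⟨b, c, hb, hmem, hmin, heq, hcut⟩ := hF t ht
  have h1 : imedIndex F arm x t c ≤ ENNReal.log (pulls arm t b) := by
    rw [← imedIndex_leader hb]; exact hmin (Or.inl rfl)
  have hcb : pulls arm t c ≤ pulls arm t b :=
    log_natCast_le_log_natCast.1 ((log_pulls_le_indexWith ..).trans h1)
  have hac : pulls arm t a ≤ pulls arm t c := by
    by_cases h : c = b
    · rw [← ha, heq h]
    · obtain ⟨S, hcS, -, -, hSmin⟩ := hcut h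
      have h2 : secondIndex F arm x t c a ≤ secondIndex F arm x t c c := ha ▸ hSmin hcS
      rw [secondIndex, secondIndex, klPos_self, indexWith_zero] at h2
      exact log_natCast_le_log_natCast.1 ((log_pulls_le_indexWith ..).trans h2)
  obtain rfl : b = astar := leader_eq_of_log_le_imedIndex hU hμ hε hgap hx hrel hund hb
    (hac.trans hcb) fun v hv => (ENNReal.log_le_log (Nat.cast_le.2 hac)).trans
      ((log_pulls_le_indexWith ..).trans (hmin (Or.inr hv)))
  have hcne : c ≠ b := fun h => hne (by rw [← ha, heq h, h])
  have hadj : G.Adj b c := hmem.resolve_left hcne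
  have hclt := hU.optimal c hcne
  obtain ⟨h3, h4⟩ := pulls_mul_toReal_le (hn.trans hac) h1
    (kl_shifted_le hμ hε hgap hx hrel hclt hac (hb.bestMean_eq ▸ hx t b)
      (hb.bestMean_eq ▸ sub_le_empMean_of_reliable hrel (hac.trans hcb)))
    (kl_shifted_ne_top hμ hε hgap hclt)
  have h5 := h4.trans (log_pulls_le_log h3)
  obtain ⟨S, hcS, hSsub, haS, hSmin⟩ := hcut hcne
  rw [ha] at haS hSmin
  by_cases hba : G.Adj b a
  · obtain rfl := eq_of_mem_cutSide_of_adj hG hadj (hSsub haS) hba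
    exact Or.inl ⟨hba, h5⟩
  · have hac' : a ≠ c := fun h => hba (h ▸ hadj)
    obtain ⟨p, hp⟩ := hU.path a hne
    have hlt : μ a < μ c :=
      lt_of_le_of_ne (le_of_mem_cutSide hG hadj p hp (hSsub haS)) (hinj.ne hac')
    refine Or.inr ⟨hba, c, pulls arm t c, hadj, hlt, hn.trans hac, h5, ?_⟩
    have h6 : secondIndex F arm x t c a ≤ secondIndex F arm x t c c := hSmin hcS
    have hra : |empMean arm x t a - μ a| < ε := by
      by_contra h; exact hrel ⟨t, a, le_rfl, not_lt.1 h⟩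
    have hrc := sub_le_empMean_of_reliable (t := t) hrel hac
    have hemp : empMean arm x t a < empMean arm x t c := by
      linarith [(abs_lt.1 hra).2, hgap a c hlt]
    rw [secondIndex, secondIndex, klPos_self, indexWith_zero, RewardFamily.klPos,
      if_pos hemp] at h6
    exact (pulls_mul_toReal_le hn h6 (kl_shifted_le hμ hε hgap hx hrel hlt le_rfl (hx t c) hrc)
      (kl_shifted_ne_top hμ hε hgap hlt)).2

lemma le_ucb {a b : A} {u : ℝ} (hu : u ∈ F.closedMeans) (hau : empMean arm x t a ≤ u)
    (h : indexWith arm t a (F.kl (empMean arm x t a) u) ≤ ENNReal.log (pulls arm t b)) :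
    (u : EReal) ≤ ucb F arm x t b a := by
  have hab : pulls arm t a ≤ pulls arm t b :=
    log_natCast_le_log_natCast.1 ((log_pulls_le_indexWith ..).trans h)
  rw [ucb, if_neg (not_lt.2 hab)]
  exact le_sSup ⟨u, ⟨hu, hau, h⟩, rfl⟩

lemma exists_of_lt_ucb {a b : A} {v : ℝ} (hab : pulls arm t a ≤ pulls arm t b)
    (h : (v : EReal) < ucb F arm x t b a) :
    ∃ u ∈ F.closedMeans, v < u ∧
      indexWith arm t a (F.kl (empMean arm x t a) u) ≤ ENNReal.log (pulls arm t b) := by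
  rw [ucb, if_neg (not_lt.2 hab), lt_sSup_iff] at h
  obtain ⟨_, ⟨u, ⟨hu, -, hidx⟩, rfl⟩, hvu⟩ := h
  exact ⟨u, hu, EReal.coe_lt_coe_iff.1 hvu, hidx⟩

lemma pulls_lt_of_indexWith_le {a : A} {m : ℕ} {k : ℝ≥0∞} (ha : 1 ≤ pulls arm t a) (hk : 0 < k)
    (h : indexWith arm t a k ≤ ENNReal.log (m : ℝ≥0∞)) : pulls arm t a < m := by
  obtain ⟨k', hk'0, hk'⟩ := exists_between hk
  have hk'top : k' ≠ ⊤ := (hk'.trans_le le_top).ne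
  have h1 := (indexWith_mono arm t a hk'.le).trans h
  rw [← ENNReal.ofReal_toReal hk'top, indexWith_ofReal ha ENNReal.toReal_nonneg] at h1
  have h2 : (Real.log (pulls arm t a) : EReal) <
      ((pulls arm t a * k'.toReal + Real.log (pulls arm t a) : ℝ) : EReal) := by
    rw [EReal.coe_lt_coe_iff]
    have : 0 < k'.toReal := ENNReal.toReal_pos hk'0.ne' hk'top
    have : (0 : ℝ) < pulls arm t a := by exact_mod_cast ha
    nlinarith [mul_pos this ‹0 < k'.toReal›]
  rw [← log_natCast ha] at h2
  have := h2.trans_le h1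
  rwa [ENNReal.log_lt_log_iff, Nat.cast_lt] at this

/-- Outside the exceptional events, the upper confidence bound of an arm that is better than the
current best arm does not fall below its mean by more than `ε`. -/
lemma sub_le_ucb_of_adj (hμ : ∀ a, μ a ∈ F.means) (hε : 0 < ε)
    (hgap : ∀ a b, μ a < μ b → μ a + 4 * ε < μ b) (hrel : ¬Unreliable μ ε arm x n)
    (hund : ¬Underrated F μ ε arm x n) {a b : A} (hb : IsLeader arm x t b)
    (hnb : n ≤ pulls arm t b) (hlt : μ b < μ a) :
    ((μ a - ε : ℝ) : EReal) ≤ ucb F arm x t b a := by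
  have hb' : |empMean arm x t b - μ b| < ε := by
    by_contra h; exact hrel ⟨t, b, hnb, not_lt.1 h⟩
  have h1 := (abs_lt.1 hb').2
  have h2 := hgap b a hlt
  have h3 := hb.1 a
  refine le_ucb (F.means_subset_closedMeans (add_sub_mem_means hμ hε hgap hlt).2)
    (by linarith) ?_
  by_contra hidx
  exact hund ⟨a, (add_sub_mem_means hμ hε hgap hlt).2, t, by linarith,
    (ENNReal.log_le_log (Nat.cast_le.2 hnb)).trans (not_le.1 hidx).le⟩

/-- Under KLUCB-UB, outside the exceptional events, the current best arm is optimal whenever an arm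
with `n ≥ 1` pulls is chosen. Otherwise the current best arm `b` would have more than `n` pulls.
At its last pull the current best arm would not be `b` itself, since the upper confidence bound of
`b` would be its empirical mean, and that of a better neighbour is larger. It would be another arm,
with at least `n` pulls, and it could not have been overtaken by `b` since both are reliable. -/
lemma FollowsKLUCBUB.leader_eq (hF : FollowsKLUCBUB F G arm x)
    (hU : IsUnimodal G μ astar) (hμ : ∀ a, μ a ∈ F.means) (hinj : Function.Injective μ)
    (hε : 0 < ε) (hgap : ∀ a b, μ a < μ b → μ a + 4 * ε < μ b)
    (hx : ∀ t a, empMean arm x t a ∈ F.closedMeans) {a b : A}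
    (hb : IsLeader arm x t b) (hmax : IsMaxOn (ucb F arm x t b) (closedNbhd G b) a)
    (hab : pulls arm t a ≤ pulls arm t b) (hn : 1 ≤ pulls arm t a)
    (hrel : ¬Unreliable μ ε arm x (pulls arm t a))
    (hund : ¬Underrated F μ ε arm x (pulls arm t a)) : b = astar := by
  have rel : ∀ s c, pulls arm t a ≤ pulls arm s c → |empMean arm x s c - μ c| < ε := by
    intro s c h; by_contra h'; exact hrel ⟨s, c, h, not_lt.1 h'⟩
  by_contra hne
  obtain ⟨v, hadj, hlt⟩ := hU.exists_adj_lt hne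
  have hg := hgap b v hlt
  have hbt := abs_lt.1 (rel t b hab)
  have h1 : ((μ v - ε : ℝ) : EReal) ≤ ucb F arm x t b a :=
    (sub_le_ucb_of_adj hμ hε hgap hrel hund hb hab hlt).trans (hmax (Or.inr hadj))
  obtain ⟨u, hu, hvu, hidx⟩ := exists_of_lt_ucb (v := μ v - 2 * ε) hab
    ((EReal.coe_lt_coe_iff.2 (by linarith)).trans_le h1)
  have h2 := hb.1 a
  have hnb : pulls arm t a < pulls arm t b :=
    pulls_lt_of_indexWith_le hn
      (RewardFamily.kl_pos (hx t a) hu (by linarith : empMean arm x t a < u).ne) hidx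
  obtain ⟨s, hst, hsb, hsn⟩ := exists_last_pull arm b t (by omega)
  have hns : pulls arm t a ≤ pulls arm s b := by omega
  have hs1 : 1 ≤ s := by
    rcases Nat.eq_zero_or_pos s with rfl | h
    · rw [pulls_zero] at hns; omega
    · exact h
  obtain ⟨c, hc, -, hcmax, hbc⟩ := hF s hs1
  rw [hsb] at hcmax hbc
  have hbs := abs_lt.1 (rel s b hns)
  by_cases hcb : c = b
  · subst hcb
    have h3 : ((μ v - ε : ℝ) : EReal) ≤ ucb F arm x s c c :=
      (sub_le_ucb_of_adj hμ hε hgap hrel hund hc hns hlt).trans (hcmax (Or.inr hadj))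
    obtain ⟨u', hu', hvu', hidx'⟩ := exists_of_lt_ucb (v := μ v - 2 * ε) le_rfl
      ((EReal.coe_lt_coe_iff.2 (by linarith)).trans_le h3)
    exact lt_irrefl _ (pulls_lt_of_indexWith_le (hn.trans hns)
      (RewardFamily.kl_pos (hx s c) hu' (by linarith : empMean arm x s c < u').ne) hidx')
  · have hcs := abs_lt.1 (rel s c (hns.trans hbc))
    have hct := abs_lt.1 (rel t c ((hns.trans hbc).trans (pulls_mono arm c hst.le)))
    have h4 := hc.1 b
    have h5 := hb.1 c
    rcases lt_or_gt_of_ne (hinj.ne hcb) with h | h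
    · linarith [hgap c b h]
    · linarith [hgap b c h]

/-- Outside the exceptional events, KLUCB-UB pulls a suboptimal arm only if it is a neighbour of the
optimal arm with few pulls. -/
lemma FollowsKLUCBUB.adj_and_pulls_mul_le (hF : FollowsKLUCBUB F G arm x)
    (hU : IsUnimodal G μ astar) (hμ : ∀ a, μ a ∈ F.means) (hinj : Function.Injective μ)
    (hε : 0 < ε) (hgap : ∀ a b, μ a < μ b → μ a + 4 * ε < μ b)
    (hx : ∀ t a, empMean arm x t a ∈ F.closedMeans) (ht : 1 ≤ t) {a : A} (ha : arm (t + 1) = a)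
    (hne : a ≠ astar) (hn : 1 ≤ pulls arm t a)
    (hrel : ¬Unreliable μ ε arm x (pulls arm t a))
    (hund : ¬Underrated F μ ε arm x (pulls arm t a)) :
    G.Adj astar a ∧
      pulls arm t a * (F.kl (μ a + ε) (μ astar - ε)).toReal ≤ Real.log t := by
  obtain ⟨b, hb, hmem, hmax, hab⟩ := hF t ht
  rw [ha] at hmem hmax hab
  obtain rfl := hF.leader_eq hU hμ hinj hε hgap hx hb hmax hab hn hrel hund
  have hadj : G.Adj b a := hmem.resolve_left hne
  have hlt := hU.optimal a hne
  have hbt : |empMean arm x t b - μ b| < ε := by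
    by_contra h'; exact hrel ⟨t, b, hab, not_lt.1 h'⟩
  have h1 : (empMean arm x t b : EReal) ≤ ucb F arm x t b a := by
    refine le_trans (le_ucb (hx t b) le_rfl ?_) (hmax (Or.inl rfl))
    rw [RewardFamily.kl_self, indexWith_zero]
  obtain ⟨u, hu, hvu, hidx⟩ := exists_of_lt_ucb (v := μ b - ε) hab
    ((EReal.coe_lt_coe_iff.2 (by linarith [(abs_lt.1 hbt).1])).trans_le h1)
  obtain ⟨h3, h4⟩ := pulls_mul_toReal_le hn hidx
    (kl_shifted_le hμ hε hgap hx hrel hlt le_rfl hu hvu.le) (kl_shifted_ne_top hμ hε hgap hlt)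
  exact ⟨hadj, h4.trans (log_pulls_le_log h3)⟩

end Paths

/-! ### The relative slack of shifted divergences -/

section Slack

variable {A : Type*} [Fintype A] {F : RewardFamily} {μ : A → ℝ} {ε : ℝ}

lemma four_mul_lt_of_lt_epsNu (hε : ε < epsNu μ) {a b : A} (hab : a ≠ b) :
    4 * ε < |μ a - μ b| := by
  have h1 : ε < ⨅ p : {p : A × A // p.1 ≠ p.2}, |μ p.1.1 - μ p.1.2| / 4 :=
    hε.trans_le (min_le_right _ _)
  have h2 := h1.trans_le (ciInf_le (Set.finite_range _).bddBelow
    (⟨(a, b), hab⟩ : {p : A × A // p.1 ≠ p.2}))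
  dsimp only at h2
  linarith

lemma injective_of_lt_epsNu (h0 : 0 < ε) (hε : ε < epsNu μ) : Function.Injective μ := by
  intro a b hab
  by_contra h
  have := four_mul_lt_of_lt_epsNu hε h
  rw [hab, sub_self, abs_zero] at this
  linarith

lemma add_four_mul_lt (hε : ε < epsNu μ) (a b : A) (hab : μ a < μ b) :
    μ a + 4 * ε < μ b := by
  have := four_mul_lt_of_lt_epsNu hε (fun h : a = b => hab.ne (congrArg μ h))
  rw [abs_of_neg (by linarith)] at this
  linarith

/-- The function `α_ν`: the sum, over the pairs of arms with `μ a < μ b`, of the relative excess of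
`KL(μ a | μ b)` over `KL(μ a + ε | μ b - ε)`. It is set to `0` outside `(0, ε_ν)`. -/
noncomputable def klSlack (F : RewardFamily) (μ : A → ℝ) (ε : ℝ) : ℝ :=
  if 0 < ε ∧ ε < epsNu μ then
    ∑ p : A × A with μ p.1 < μ p.2,
      ((F.kl (μ p.1) (μ p.2)).toReal / (F.kl (μ p.1 + ε) (μ p.2 - ε)).toReal - 1)
  else 0

lemma toReal_kl_shifted_pos (hμ : ∀ a, μ a ∈ F.means) (h0 : 0 < ε) (hε : ε < epsNu μ) {a b : A}
    (hab : μ a < μ b) : 0 < (F.kl (μ a + ε) (μ b - ε)).toReal := by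
  obtain ⟨h1, h2⟩ := add_sub_mem_means hμ h0 (add_four_mul_lt hε) hab
  exact RewardFamily.toReal_kl_pos (F.means_subset_closedMeans h1) h2
    (by linarith [add_four_mul_lt hε a b hab] : μ a + ε < μ b - ε).ne

lemma toReal_kl_shifted_anti (hμ : ∀ a, μ a ∈ F.means) (h0 : 0 < ε) (hε : ε < epsNu μ) {a b : A}
    (hab : μ a < μ b) {δ : ℝ} (hδ0 : 0 ≤ δ) (hδ : δ ≤ ε) :
    (F.kl (μ a + ε) (μ b - ε)).toReal ≤ (F.kl (μ a + δ) (μ b - δ)).toReal := by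
  have hg := add_four_mul_lt hε a b hab
  obtain ⟨h1, h2⟩ := add_sub_mem_means hμ h0 (add_four_mul_lt hε) hab
  have h3 : μ a + δ ∈ F.means :=
    F.ordConnected_means.out (hμ a) (hμ b) ⟨by linarith, by linarith⟩
  have h4 : μ b - δ ∈ F.means :=
    F.ordConnected_means.out (hμ a) (hμ b) ⟨by linarith, by linarith⟩
  exact ENNReal.toReal_mono (RewardFamily.kl_ne_top (F.means_subset_closedMeans h3) h4)
    (RewardFamily.kl_le_kl (F.means_subset_closedMeans h3) (F.means_subset_closedMeans h4)
      (by linarith) (by linarith) (by linarith) (F.means_subset_closedMeans h1))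

lemma klSlack_term_nonneg (hμ : ∀ a, μ a ∈ F.means) (h0 : 0 < ε) (hε : ε < epsNu μ) {a b : A}
    (hab : μ a < μ b) :
    0 ≤ (F.kl (μ a) (μ b)).toReal / (F.kl (μ a + ε) (μ b - ε)).toReal - 1 := by
  rw [sub_nonneg, one_le_div (toReal_kl_shifted_pos hμ h0 hε hab)]
  simpa using toReal_kl_shifted_anti hμ h0 hε hab le_rfl h0.le

lemma klSlack_nonneg (hμ : ∀ a, μ a ∈ F.means) (ε : ℝ) : 0 ≤ klSlack F μ ε := by
  unfold klSlack
  split_ifs with h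
  · exact Finset.sum_nonneg fun p hp => klSlack_term_nonneg hμ h.1 h.2 (Finset.mem_filter.1 hp).2
  · exact le_rfl

lemma monotoneOn_klSlack (hμ : ∀ a, μ a ∈ F.means) :
    MonotoneOn (klSlack F μ) (Set.Ioo 0 (epsNu μ)) := by
  intro δ hδ ε hε hle
  rw [klSlack, klSlack, if_pos ⟨hδ.1, hδ.2⟩, if_pos ⟨hε.1, hε.2⟩]
  refine Finset.sum_le_sum fun p hp => ?_
  have hp' := (Finset.mem_filter.1 hp).2
  have h1 := toReal_kl_shifted_pos hμ hε.1 hε.2 hp'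
  have h2 := toReal_kl_shifted_anti hμ hε.1 hε.2 hp' hδ.1.le hle
  gcongr

lemma RewardFamily.continuousAt_klReal_shifted {F : RewardFamily} {x y : ℝ} (hx : x ∈ F.means)
    (hy : y ∈ F.means) : ContinuousAt (fun ε => F.klReal (x + ε) (y - ε)) 0 := by
  cases F
  · simp only [RewardFamily.klReal]; fun_prop
  · obtain ⟨hx0, hx1⟩ := hx
    obtain ⟨hy0, hy1⟩ := hy
    have h1 : y - 0 ≠ 0 := by linarith
    have h2 : 1 - (y - 0) ≠ 0 := by linarith
    have h3 : (x + 0) / (y - 0) ≠ 0 := div_ne_zero (by linarith) h1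
    have h4 : (1 - (x + 0)) / (1 - (y - 0)) ≠ 0 := div_ne_zero (by linarith) h2
    simp only [RewardFamily.klReal]
    fun_prop (disch := assumption)

lemma tendsto_klSlack (hμ : ∀ a, μ a ∈ F.means) : Tendsto (klSlack F μ) (𝓝[>] 0) (𝓝 0) := by
  by_cases hpos : 0 < epsNu μ
  · have hev : ∀ᶠ ε in 𝓝[>] (0 : ℝ), ε ∈ Set.Ioo 0 (epsNu μ) := Ioo_mem_nhdsGT hpos
    have hlim : Tendsto (fun ε => ∑ p : A × A with μ p.1 < μ p.2,
        ((F.kl (μ p.1) (μ p.2)).toReal / F.klReal (μ p.1 + ε) (μ p.2 - ε) - 1))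
        (𝓝[>] 0) (𝓝 (∑ p : A × A with μ p.1 < μ p.2, 0)) := by
      refine tendsto_finsetSum _ fun p hp => ?_
      have hp' := (Finset.mem_filter.1 hp).2
      have hx := F.means_subset_closedMeans (hμ p.1)
      have hc := (RewardFamily.continuousAt_klReal_shifted (hμ p.1) (hμ p.2)).tendsto
      simp only [add_zero, sub_zero] at hc
      have h0 := RewardFamily.toReal_kl_pos hx (hμ p.2) hp'.ne
      rw [← RewardFamily.toReal_kl hx (hμ p.2)] at hc
      have := ((tendsto_const_nhds (x := (F.kl (μ p.1) (μ p.2)).toReal)).div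
        (hc.mono_left (nhdsWithin_le_nhds (s := Set.Ioi 0))) h0.ne').sub_const 1
      rwa [div_self h0.ne', sub_self] at this
    rw [Finset.sum_const_zero] at hlim
    refine hlim.congr' ?_
    filter_upwards [hev] with ε hε
    rw [klSlack, if_pos ⟨hε.1, hε.2⟩]
    refine Finset.sum_congr rfl fun p hp => ?_
    obtain ⟨h1, h2⟩ := add_sub_mem_means hμ hε.1 (add_four_mul_lt hε.2) (Finset.mem_filter.1 hp).2
    rw [RewardFamily.toReal_kl (F.means_subset_closedMeans h1) h2]
  · have : klSlack F μ = fun _ => 0 := by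
      ext ε
      rw [klSlack, if_neg fun h => hpos (h.1.trans h.2)]
    rw [this]
    exact tendsto_const_nhds

lemma div_one_add_klSlack_le (hμ : ∀ a, μ a ∈ F.means) (h0 : 0 < ε) (hε : ε < epsNu μ) {a b : A}
    (hab : μ a < μ b) :
    (F.kl (μ a) (μ b)).toReal / (1 + klSlack F μ ε) ≤ (F.kl (μ a + ε) (μ b - ε)).toReal := by
  have hD := toReal_kl_shifted_pos hμ h0 hε hab
  have h1 : (F.kl (μ a) (μ b)).toReal / (F.kl (μ a + ε) (μ b - ε)).toReal - 1
      ≤ klSlack F μ ε := by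
    rw [klSlack, if_pos ⟨h0, hε⟩]
    exact Finset.single_le_sum (f := fun p : A × A =>
      (F.kl (μ p.1) (μ p.2)).toReal / (F.kl (μ p.1 + ε) (μ p.2 - ε)).toReal - 1)
      (fun p hp => klSlack_term_nonneg hμ h0 hε (Finset.mem_filter.1 hp).2)
      (Finset.mem_filter.2 ⟨Finset.mem_univ (a, b), hab⟩)
  have h2 := klSlack_nonneg (F := F) hμ ε
  rw [sub_le_iff_le_add', div_le_iff₀ hD] at h1
  rw [div_le_iff₀ (by linarith)]
  linarith

lemma toReal_kl_shifted_le (hμ : ∀ a, μ a ∈ F.means) (h0 : 0 < ε) (hε : ε < epsNu μ) {a b : A}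
    (hab : μ a < μ b) :
    (F.kl (μ a + ε) (μ b - ε)).toReal ≤ (1 + klSlack F μ ε) * (F.kl (μ a) (μ b)).toReal := by
  have h1 : (F.kl (μ a + ε) (μ b - ε)).toReal ≤ (F.kl (μ a) (μ b)).toReal := by
    simpa using toReal_kl_shifted_anti hμ h0 hε hab le_rfl h0.le
  exact h1.trans (le_mul_of_one_le_left ENNReal.toReal_nonneg
    (by linarith [klSlack_nonneg (F := F) hμ ε]))

/-- A shifted divergence is replaced by the unshifted one at the price of a factor
`1 + klSlack F μ ε`. -/
lemma le_slack_div_mul (hμ : ∀ a, μ a ∈ F.means) (h0 : 0 < ε) (hε : ε < epsNu μ) {a b : A}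
    (hab : μ a < μ b) {n L : ℝ} (hn : 0 ≤ n)
    (h : n * (F.kl (μ a + ε) (μ b - ε)).toReal ≤ L) :
    n ≤ (1 + klSlack F μ ε) / (F.kl (μ a) (μ b)).toReal * L := by
  have hK := RewardFamily.toReal_kl_pos (F.means_subset_closedMeans (hμ a)) (hμ b) hab.ne
  have h1 : 0 < 1 + klSlack F μ ε := by linarith [klSlack_nonneg (F := F) hμ ε]
  have h2 := (mul_le_mul_of_nonneg_left (div_one_add_klSlack_le hμ h0 hε hab) hn).trans h
  rw [div_mul_eq_mul_div, le_div_iff₀ hK]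
  rw [mul_div_assoc', div_le_iff₀ h1] at h2
  linarith

end Slack

/-! ### From sample paths to expectations -/

lemma exists_pull_of_lt_pulls {A : Type*} [DecidableEq A] (arm : ℕ → A) (a : A) {n T : ℕ}
    (h : n < pulls arm T a) : ∃ t < T, arm (t + 1) = a ∧ pulls arm t a = n := by
  induction T with
  | zero => simp [pulls_zero] at h
  | succ T ih =>
    by_cases hT : n < pulls arm T a
    · obtain ⟨t, ht, h1⟩ := ih hT
      exact ⟨t, by omega, h1⟩
    · rw [pulls_succ] at h
      by_cases ha : arm (T + 1) = a
      · rw [if_pos ha] at h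
        exact ⟨T, by omega, ha, by omega⟩
      · rw [if_neg ha] at h; omega

/-- The pulls of an arm are counted by the number `n` of its previous pulls. The value `n = 0`
accounts for the summand `1`. -/
lemma pulls_le_of_forall {A : Type*} [DecidableEq A] {arm : ℕ → A} {a : A} {T : ℕ} {B : ℝ}
    (hB : 0 ≤ B) (bad : ℕ → Prop) [DecidablePred bad]
    (h : ∀ t, 1 ≤ t → t < T → arm (t + 1) = a → 1 ≤ pulls arm t a → ¬bad (pulls arm t a) →
      (pulls arm t a : ℝ) ≤ B) :
    (pulls arm T a : ℝ) ≤ B + 1 + ∑ n ∈ Finset.Icc 1 T, if bad n then 1 else 0 := by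
  have hsub : Finset.Icc 1 (pulls arm T a - 1) ⊆
      Finset.Icc 1 ⌊B⌋₊ ∪ (Finset.Icc 1 T).filter bad := by
    intro n hn
    rw [Finset.mem_Icc] at hn
    obtain ⟨t, htT, ha, htn⟩ := exists_pull_of_lt_pulls arm a (show n < pulls arm T a by omega)
    have ht1 : 1 ≤ t := by
      rcases Nat.eq_zero_or_pos t with rfl | ht
      · rw [pulls_zero] at htn; omega
      · exact ht
    rw [Finset.mem_union, Finset.mem_filter, Finset.mem_Icc, Finset.mem_Icc]
    by_cases hb : bad n
    · exact Or.inr ⟨⟨hn.1, by have := pulls_le arm T a; omega⟩, hb⟩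
    · refine Or.inl ⟨hn.1, Nat.le_floor ?_⟩
      rw [← htn]
      exact h t ht1 htT ha (by omega) (htn ▸ hb)
  have hc := (Finset.card_le_card hsub).trans (Finset.card_union_le _ _)
  rw [Nat.card_Icc, Nat.card_Icc] at hc
  have hc' : pulls arm T a ≤ 1 + (⌊B⌋₊ + ((Finset.Icc 1 T).filter bad).card) := by omega
  have hfl := Nat.floor_le hB
  calc (pulls arm T a : ℝ) ≤ 1 + (⌊B⌋₊ + ((Finset.Icc 1 T).filter bad).card) := by
        exact_mod_cast hc'
    _ ≤ _ := by
        rw [Finset.sum_boole]; linarith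

lemma IsBanditRun.ae_empMean_mem {A Ω : Type*} [DecidableEq A] {mΩ : MeasurableSpace Ω}
    {P : Measure Ω} [IsProbabilityMeasure P] {ℱ : Filtration ℕ mΩ} {F : RewardFamily} {μ : A → ℝ}
    {arm : ℕ → Ω → A} {X : ℕ → Ω → ℝ} (h : IsBanditRun P ℱ (fun a => F.law (μ a)) arm X)
    (hμ : ∀ a, μ a ∈ F.closedMeans) :
    ∀ᵐ ω ∂P, ∀ t a, empMean (fun s => arm s ω) (fun s => X s ω) t a ∈ F.closedMeans := by
  cases F
  · exact ae_of_all _ fun _ _ _ => Set.mem_univ _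
  · filter_upwards [h.ae_forall_reward_zero_or_one hμ] with ω hX t a
    have hX' : ∀ s ∈ pullTimes (fun s => arm s ω) t a, 0 ≤ X s ω ∧ X s ω ≤ 1 := by
      intro s hs
      have hs1 : 1 ≤ s := (Finset.mem_Icc.1 (Finset.mem_filter.1 hs).1).1
      obtain ⟨s, rfl⟩ := Nat.exists_eq_add_of_le' hs1
      rcases hX s with h | h
      · simp [h]
      · rw [Set.mem_singleton_iff.1 h]; simp
    refine ⟨div_nonneg (Finset.sum_nonneg fun s hs => (hX' s hs).1) (Nat.cast_nonneg _),
      div_le_one_of_le₀ ?_ (Nat.cast_nonneg _)⟩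
    refine (Finset.sum_le_card_nsmul _ _ 1 fun s hs => (hX' s hs).2).trans ?_
    rw [nsmul_eq_mul, mul_one]
    rfl

/-- The constant `C_ε` absorbs `5 ε⁻⁶`, because `log (1 / ε) ≥ log 2` for `ε ≤ 1 / 2`. -/
lemma exceptional_bound_le {ε d N : ℝ} (hε : 0 < ε) (hε2 : ε ≤ 1 / 2) (hd : 1 ≤ d) (hN : 1 ≤ N) :
    N * (5 * ε⁻¹ ^ 6) ≤ d * N ^ 2 * Ceps ε := by
  have h1 : Real.log 2 ≤ Real.log (1 / ε) :=
    Real.log_le_log two_pos (by rw [le_div_iff₀ hε]; linarith)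
  have h2 := Real.log_two_gt_d9
  have h3 : 0 < ε⁻¹ ^ 6 := by positivity
  have h4 : 5 * ε⁻¹ ^ 6 ≤ Ceps ε := by
    rw [Ceps]; gcongr; linarith
  have h5 : N ≤ d * N ^ 2 := by nlinarith [mul_nonneg (sub_nonneg.2 hd) (sq_nonneg N)]
  exact mul_le_mul h5 h4 (by positivity) (by positivity)

lemma one_le_maxDegree {A : Type*} [Fintype A] {G : SimpleGraph A} [DecidableRel G.Adj]
    {μ : A → ℝ} {astar a : A} (hU : IsUnimodal G μ astar) (ha : a ≠ astar) : 1 ≤ G.maxDegree := by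
  obtain ⟨v, hv, -⟩ := hU.exists_adj_lt ha
  exact ((G.degree_pos_iff_exists_adj a).2 ⟨v, hv⟩).trans_le (G.degree_le_maxDegree a)

/-- If, outside the exceptional events, arm `a` is pulled only while it has at most `B` pulls, then
its expected number of pulls exceeds `B + 1` by at most the total probability of the exceptional
events. -/
lemma IsBanditRun.integral_pulls_le {A Ω : Type*} [Fintype A] [DecidableEq A]
    {mΩ : MeasurableSpace Ω} {P : Measure Ω} [IsProbabilityMeasure P] {ℱ : Filtration ℕ mΩ}
    {F : RewardFamily} {μ : A → ℝ} {arm : ℕ → Ω → A} {X : ℕ → Ω → ℝ}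
    (h : IsBanditRun P ℱ (fun a => F.law (μ a)) arm X) (hμ : ∀ a, μ a ∈ F.means) {ε : ℝ}
    (hε : 0 < ε) (hε2 : ε ≤ 1 / 2) {T : ℕ} {a : A} {B : ℝ}
    (hB : 0 ≤ B) {d : ℝ} (hd : 1 ≤ d)
    (hpath : ∀ᵐ ω ∂P, ∀ t, 1 ≤ t → t < T → arm (t + 1) ω = a →
      1 ≤ pulls (fun s => arm s ω) t a →
      ¬Unreliable μ ε (fun s => arm s ω) (fun s => X s ω) (pulls (fun s => arm s ω) t a) →
      ¬Underrated F μ ε (fun s => arm s ω) (fun s => X s ω) (pulls (fun s => arm s ω) t a) →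
      (pulls (fun s => arm s ω) t a : ℝ) ≤ B) :
    ∫ ω, (pulls (fun s => arm s ω) T a : ℝ) ∂P
      ≤ B + d * (Fintype.card A : ℝ) ^ 2 * Ceps ε + 1 := by
  classical
  let bad : ℕ → Set Ω := fun n => {ω | Unreliable μ ε (fun s => arm s ω) (fun s => X s ω) n ∨
    Underrated F μ ε (fun s => arm s ω) (fun s => X s ω) n}
  -- The exceptional events are replaced by measurable hulls.
  let hull : ℕ → Set Ω := fun n => toMeasurable P (bad n)
  have hm : ∀ n, MeasurableSet (hull n) := fun n => measurableSet_toMeasurable _ _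
  have hi : ∀ n, Integrable ((hull n).indicator fun _ => (1 : ℝ)) P := fun n =>
    (integrable_const _).indicator (hm n)
  have hsum : ∑ n ∈ Finset.Icc 1 T, P.real (bad n) ≤ Fintype.card A * (5 * ε⁻¹ ^ 6) := by
    have h1 := h.sum_measure_exceptional_le hμ hε hε2 T
    have h2 := ENNReal.toReal_le_of_le_ofReal (by positivity) h1
    rwa [ENNReal.toReal_sum fun _ _ => measure_ne_top _ _] at h2
  have hcard : (1 : ℝ) ≤ Fintype.card A := by
    exact_mod_cast Fintype.card_pos_iff.2 ⟨a⟩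
  calc ∫ ω, (pulls (fun s => arm s ω) T a : ℝ) ∂P
      ≤ ∫ ω, (B + 1 + ∑ n ∈ Finset.Icc 1 T, (hull n).indicator (fun _ => (1 : ℝ)) ω) ∂P := by
        refine integral_mono_of_nonneg (ae_of_all _ fun ω => Nat.cast_nonneg _)
          ((integrable_const _).add (integrable_finsetSum _ fun n _ => hi n)) ?_
        filter_upwards [hpath] with ω hω
        refine (pulls_le_of_forall hB (fun n => ω ∈ bad n) fun t h1 h2 h3 h4 h5 =>
          hω t h1 h2 h3 h4 (fun h => h5 (Or.inl h)) fun h => h5 (Or.inr h)).trans ?_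
        refine add_le_add le_rfl (Finset.sum_le_sum fun n _ => ?_)
        split_ifs with hb
        · rw [Set.indicator_of_mem (subset_toMeasurable _ _ hb)]
        · exact Set.indicator_nonneg (fun _ _ => zero_le_one) _
    _ = B + 1 + ∑ n ∈ Finset.Icc 1 T, P.real (bad n) := by
        rw [integral_add (integrable_const _) (integrable_finsetSum _ fun n _ => hi n),
          integral_finsetSum _ fun n _ => hi n]
        congr 1
        · simp
        · refine Finset.sum_congr rfl fun n _ => ?_
          rw [integral_indicator_const _ (hm n)]
          simp [Measure.real, hull, measure_toMeasurable]
    _ ≤ _ := by linarith [exceptional_bound_le hε hε2 hd hcard]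

end UnimodalBandit

open UnimodalBandit in
theorem mainTheorem1 {A : Type*} [Fintype A] [DecidableEq A] (F : RewardFamily) (μ : A → ℝ)
    (hμ : ∀ a, μ a ∈ F.means) :
    ∃ α : ℝ → ℝ,
      (∀ ε, 0 ≤ α ε) ∧ Tendsto α (𝓝[>] 0) (𝓝 0) ∧ MonotoneOn α (Set.Ioo 0 (epsNu μ)) ∧
      (∀ ε, 0 < ε → ε < epsNu μ → ∀ a b : A, μ a < μ b →
        (F.kl (μ a) (μ b)).toReal / (1 + α ε) ≤ (F.kl (μ a + ε) (μ b - ε)).toReal ∧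
        (F.kl (μ a + ε) (μ b - ε)).toReal ≤ (1 + α ε) * (F.kl (μ a) (μ b)).toReal) ∧
      ∀ (G : SimpleGraph A) [DecidableRel G.Adj] (astar : A), IsUnimodal G μ astar →
      ∀ {Ω : Type*} {mΩ : MeasurableSpace Ω} (P : Measure Ω) [IsProbabilityMeasure P]
        (ℱ : Filtration ℕ mΩ) (arm : ℕ → Ω → A) (X : ℕ → Ω → ℝ),
        IsBanditRun P ℱ (fun a => F.law (μ a)) arm X →
      ∀ ε : ℝ, 0 < ε → ε < epsNu μ → ε ≤ 1 / 2 → ∀ T : ℕ, 1 ≤ T →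
        (((∀ᵐ ω ∂P, FollowsIMEDUB F G (fun s => arm s ω) (fun s => X s ω)) ∨
            (∀ᵐ ω ∂P, FollowsKLUCBUB F G (fun s => arm s ω) (fun s => X s ω))) →
          (∀ a, G.Adj astar a →
            ∫ ω, (pulls (fun s => arm s ω) T a : ℝ) ∂P ≤
              (1 + α ε) / (F.kl (μ a) (μ astar)).toReal * Real.log T
                + (G.maxDegree : ℝ) * (Fintype.card A : ℝ) ^ 2 * Ceps ε + 1) ∧
          (∀ a, a ≠ astar → ¬ G.Adj astar a →
            ∫ ω, (pulls (fun s => arm s ω) T a : ℝ) ∂P ≤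
              (G.maxDegree : ℝ) * (Fintype.card A : ℝ) ^ 2 * Ceps ε + 1)) ∧
        (G.IsTree → (∀ᵐ ω ∂P, FollowsDIMEDUB F G (fun s => arm s ω) (fun s => X s ω)) →
          (∀ a, G.Adj astar a →
            ∫ ω, (pulls (fun s => arm s ω) T a : ℝ) ∂P ≤
              (1 + α ε) / (F.kl (μ a) (μ astar)).toReal * Real.log T
                + (G.maxDegree : ℝ) * (Fintype.card A : ℝ) ^ 2 * Ceps ε + 1) ∧
          (∀ a, a ≠ astar → ¬ G.Adj astar a →
            ∫ ω, (pulls (fun s => arm s ω) T a : ℝ) ∂P ≤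
              (1 + α ε) / (⨅ c : G.neighborSet astar, (F.kl (μ a) (μ c)).toReal)
                  * Real.posLog ((1 + α ε)
                      / (⨅ c : G.neighborSet astar, (F.kl (μ c) (μ astar)).toReal) * Real.log T)
                + (G.maxDegree : ℝ) * (Fintype.card A : ℝ) ^ 2 * Ceps ε + 1)) := by
  refine ⟨klSlack F μ, klSlack_nonneg hμ, tendsto_klSlack hμ, monotoneOn_klSlack hμ,
    fun ε h0 hε a b hab =>
      ⟨div_one_add_klSlack_le hμ h0 hε hab, toReal_kl_shifted_le hμ h0 hε hab⟩, ?_⟩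
  intro G _ astar hU Ω mΩ P _ ℱ arm X hrun ε h0 hε hε2 T hT
  have hinj := injective_of_lt_epsNu h0 hε
  have hgap := add_four_mul_lt hε
  have hα := klSlack_nonneg (F := F) hμ ε
  have hmean := hrun.ae_empMean_mem fun a => F.means_subset_closedMeans (hμ a)
  have hlogT : 0 ≤ Real.log T := Real.log_natCast_nonneg T
  have hd : ∀ a, a ≠ astar → (1 : ℝ) ≤ G.maxDegree := fun a ha => by
    exact_mod_cast one_le_maxDegree hU ha
  have hlog : ∀ t : ℕ, 1 ≤ t → t < T → Real.log t ≤ Real.log T := fun t h1 h2 =>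
    Real.log_le_log (by exact_mod_cast h1) (by exact_mod_cast h2.le)
  refine ⟨fun halg => ?_, fun hG halg => ?_⟩
  · have hpath : ∀ a, a ≠ astar → ∀ᵐ ω ∂P, ∀ t, 1 ≤ t → t < T → arm (t + 1) ω = a →
        1 ≤ pulls (fun s => arm s ω) t a →
        ¬Unreliable μ ε (fun s => arm s ω) (fun s => X s ω) (pulls (fun s => arm s ω) t a) →
        ¬Underrated F μ ε (fun s => arm s ω) (fun s => X s ω) (pulls (fun s => arm s ω) t a) →
        G.Adj astar a ∧ (pulls (fun s => arm s ω) t a : ℝ) ≤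
          (1 + klSlack F μ ε) / (F.kl (μ a) (μ astar)).toReal * Real.log T := by
      intro a ha
      have hboth : ∀ᵐ ω ∂P, FollowsIMEDUB F G (fun s => arm s ω) (fun s => X s ω) ∨
          FollowsKLUCBUB F G (fun s => arm s ω) (fun s => X s ω) :=
        halg.elim (fun h => h.mono fun _ => Or.inl) fun h => h.mono fun _ => Or.inr
      filter_upwards [hboth, hmean] with ω hω hx t h1 h2 harm hn hrel hund
      have key : G.Adj astar a ∧ pulls (fun s => arm s ω) t a *
          (F.kl (μ a + ε) (μ astar - ε)).toReal ≤ Real.log t := by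
        rcases hω with hω | hω
        · exact hω.adj_and_pulls_mul_le hU hμ h0 hgap hx h1 harm ha hn hrel hund
        · exact hω.adj_and_pulls_mul_le hU hμ hinj h0 hgap hx h1 harm ha hn hrel hund
      exact ⟨key.1, le_slack_div_mul hμ h0 hε (hU.optimal a ha) (Nat.cast_nonneg _)
        (key.2.trans (hlog t h1 h2))⟩
    refine ⟨fun a hadj => ?_, fun a ha hadj => ?_⟩
    · refine hrun.integral_pulls_le hμ h0 hε2 (by positivity) (hd a hadj.ne') ?_
      filter_upwards [hpath a hadj.ne'] with ω hω t h1 h2 h3 h4 h5 h6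
      exact (hω t h1 h2 h3 h4 h5 h6).2
    · have := hrun.integral_pulls_le hμ h0 hε2 (T := T) (a := a) le_rfl (hd a ha) (by
        filter_upwards [hpath a ha] with ω hω t h1 h2 h3 h4 h5 h6
        exact absurd (hω t h1 h2 h3 h4 h5 h6).1 hadj)
      rwa [zero_add] at this
  · refine ⟨fun a hadj => ?_, fun a ha hadj => ?_⟩
    · refine hrun.integral_pulls_le hμ h0 hε2 (by positivity) (hd a hadj.ne') ?_
      filter_upwards [halg, hmean] with ω hω hx t h1 h2 h3 h4 h5 h6
      rcases hω.pulls_mul_le hG hU hμ hinj h0 hgap hx h1 h3 hadj.ne' h4 h5 h6 with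
        ⟨-, h⟩ | ⟨h, -⟩
      · exact le_slack_div_mul hμ h0 hε (hU.optimal a hadj.ne') (Nat.cast_nonneg _)
          (h.trans (hlog t h1 h2))
      · exact absurd hadj h
    · have hI1 : 0 ≤ ⨅ c : G.neighborSet astar, (F.kl (μ a) (μ c)).toReal :=
        Real.iInf_nonneg fun _ => ENNReal.toReal_nonneg
      refine hrun.integral_pulls_le hμ h0 hε2
        (mul_nonneg (div_nonneg (by linarith) hI1) Real.posLog_nonneg) (hd a ha) ?_
      filter_upwards [halg, hmean] with ω hω hx t h1 h2 h3 h4 h5 h6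
      rcases hω.pulls_mul_le hG hU hμ hinj h0 hgap hx h1 h3 ha h4 h5 h6 with
        ⟨h, -⟩ | ⟨-, c, m, hc, hac, hm, hmT, hn⟩
      · exact absurd h hadj
      have hmem : c ∈ G.neighborSet astar := hc
      have hne : Nonempty (G.neighborSet astar) := ⟨⟨c, hmem⟩⟩
      -- Both minima are attained, hence positive, because the means are distinct.
      have hpos1 : 0 < ⨅ c : G.neighborSet astar, (F.kl (μ a) (μ c)).toReal := by
        obtain ⟨v, hv⟩ := exists_eq_ciInf_of_finite
          (f := fun c : G.neighborSet astar => (F.kl (μ a) (μ c)).toReal)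
        rw [← hv]
        refine RewardFamily.toReal_kl_pos (F.means_subset_closedMeans (hμ a)) (hμ v)
          (hinj.ne fun h => hadj (h ▸ v.2))
      have hpos2 : 0 < ⨅ c : G.neighborSet astar, (F.kl (μ c) (μ astar)).toReal := by
        obtain ⟨v, hv⟩ := exists_eq_ciInf_of_finite
          (f := fun c : G.neighborSet astar => (F.kl (μ c) (μ astar)).toReal)
        rw [← hv]
        exact RewardFamily.toReal_kl_pos (F.means_subset_closedMeans (hμ v)) (hμ astar)
          (hinj.ne (G.ne_of_adj v.2).symm)
      have hle1 : ⨅ c : G.neighborSet astar, (F.kl (μ a) (μ c)).toReal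
          ≤ (F.kl (μ a) (μ c)).toReal :=
        ciInf_le (Set.finite_range _).bddBelow (⟨c, hmem⟩ : G.neighborSet astar)
      have hle2 : ⨅ c : G.neighborSet astar, (F.kl (μ c) (μ astar)).toReal
          ≤ (F.kl (μ c) (μ astar)).toReal :=
        ciInf_le (f := fun c : G.neighborSet astar => (F.kl (μ c) (μ astar)).toReal)
          (Set.finite_range _).bddBelow (⟨c, hmem⟩ : G.neighborSet astar)
      have hm1 := le_slack_div_mul hμ h0 hε (hU.optimal c hc.ne') (Nat.cast_nonneg _)
        (hmT.trans (hlog t h1 h2))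
      have hm2 : (m : ℝ) ≤ (1 + klSlack F μ ε)
          / (⨅ c : G.neighborSet astar, (F.kl (μ c) (μ astar)).toReal) * Real.log T :=
        hm1.trans (by gcongr)
      have hlm : Real.log m ≤ Real.posLog ((1 + klSlack F μ ε)
          / (⨅ c : G.neighborSet astar, (F.kl (μ c) (μ astar)).toReal) * Real.log T) := by
        rw [← Real.log_of_nat_eq_posLog]
        exact Real.posLog_le_posLog (Nat.cast_nonneg _) hm2
      refine (le_slack_div_mul hμ h0 hε hac (Nat.cast_nonneg _) (hn.trans hlm)).trans ?_
      have := Real.posLog_nonneg (x := (1 + klSlack F μ ε)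
          / (⨅ c : G.neighborSet astar, (F.kl (μ c) (μ astar)).toReal) * Real.log T)
      gcongr
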